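/- Let $M\subseteq B(H)$ and $S\subseteq B(K)$ be type II$_1$ von Neumann algebras (not necessarily factors, and not necessarily with separable predual), with $S$ hyperfinite, and let $R\subseteq M$ be a hyperfinite von Neumann subalgebra (containing the identity of $M$) with $R'\cap M=Z(M)$, the center of $M$. Here a von Neumann algebra is called hyperfinite if it is the ultraweak closure of the union of an upward directed family of finite-dimensional $*$-subalgebras. Let $$\phi\colon (M\overline\otimes S)\times(M\overline\otimes S)\to M\overline\otimes S$$ be a bounded bilinear map which is separately normal (ultraweakly continuous in each variable) and $R\overline\otimes S$-multimodular, that is, $$\phi(rx,y)=r\phi(x,y),\qquad \phi(xr,y)=\phi(x,ry),\qquad \phi(x,yr)=\phi(x,y)r$$ for all $r\in R\overline\otimes S$ and $x,y\in M\overline\otimes S$. Then $\phi$ is completely bounded: there is a constant $C$ such that, for every $n\ge 1$, the amplification $$\phi_n\colon \mathbb M_n(M\overline\otimes S)\times \mathbb M_n(M\overline\otimes S)\to \mathbb M_n(M\overline\otimes S),\qquad \phi_n(X,Y)_{ij}=\sum_{k=1}^n\phi(X_{ik},Y_{kj}),$$ satisfies $\|\phi_n(X,Y)\|\le C\|X\|\|Y\|$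 for all $X,Y$. -/

import Mathlib

open scoped TensorProduct

noncomputable section

namespace VNTensor

universe u v

section Operators

variable {H : Type u} [NormedAddCommGroup H] [InnerProductSpace ℂ H] [CompleteSpace H]

/-- The von Neumann algebra on `H` generated by a set `s` of operators: the double commutant of
`s ∪ s*`. -/
def generated (s : Set (H →L[ℂ] H)) : VonNeumannAlgebra H where
  toStarSubalgebra :=
    StarSubalgebra.centralizer ℂ (StarSubalgebra.centralizer ℂ s : Set (H →L[ℂ] H))
  centralizer_centralizer' := by
    change Set.centralizer (Set.centralizer
      ((StarSubalgebra.centralizer ℂ (StarSubalgebra.centralizer ℂ s : Set (H →L[ℂ] H)) :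
        StarSubalgebra ℂ (H →L[ℂ] H)) : Set (H →L[ℂ] H))) =
      ((StarSubalgebra.centralizer ℂ (StarSubalgebra.centralizer ℂ s : Set (H →L[ℂ] H)) :
        StarSubalgebra ℂ (H →L[ℂ] H)) : Set (H →L[ℂ] H))
    rw [StarSubalgebra.coe_centralizer_centralizer]
    simp

theorem coe_generated (s : Set (H →L[ℂ] H)) :
    (generated s : Set (H →L[ℂ] H)) = (s ∪ star s).centralizer.centralizer :=
  StarSubalgebra.coe_centralizer_centralizer ℂ s

theorem generated_mono {s t : Set (H →L[ℂ] H)} (h : s ⊆ t) : generated s ≤ generated t := by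
  intro x hx
  rw [← SetLike.mem_coe, coe_generated] at hx ⊢
  exact Set.centralizer_subset (Set.centralizer_subset
    (Set.union_subset_union h (Set.preimage_mono h))) hx

/-- The ultraweak (`σ`-weak) topology on `B(H)`: the coarsest topology making all functionals
`x ↦ ∑ₖ ⟪ξₖ, x ηₖ⟫` continuous, where `(ξₖ)` and `(ηₖ)` are square-summable sequences in `H`. -/
abbrev ultraweak (H : Type u) [NormedAddCommGroup H] [InnerProductSpace ℂ H] :
    TopologicalSpace (H →L[ℂ] H) :=
  ⨅ p : lp (fun _ : ℕ => H) 2 × lp (fun _ : ℕ => H) 2,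
    TopologicalSpace.induced (fun x : H →L[ℂ] H => ∑' k, inner ℂ (p.1 k) (x (p.2 k))) inferInstance

/-- A map of a von Neumann algebra to itself is normal if it is ultraweakly continuous. -/
def IsNormal (N : VonNeumannAlgebra H) (f : N.toStarSubalgebra → N.toStarSubalgebra) : Prop :=
  @Continuous _ _ (TopologicalSpace.induced Subtype.val (ultraweak H))
    (TopologicalSpace.induced Subtype.val (ultraweak H)) f

/-- `N` is a finite von Neumann algebra: its isometries are unitary, i.e. its identity is not
equivalent to a proper subprojection. -/
def IsFinite (N : VonNeumannAlgebra H) : Prop :=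
  ∀ v ∈ N, star v * v = 1 → v * star v = 1

/-- `e` is an abelian projection of `N`: `e N e` is commutative. -/
def IsAbelianProjection (N : VonNeumannAlgebra H) (e : H →L[ℂ] H) : Prop :=
  e ∈ N ∧ IsStarProjection e ∧
    ∀ x ∈ N, ∀ y ∈ N, (e * x * e) * (e * y * e) = (e * y * e) * (e * x * e)

/-- `N` is of type `II₁`: it is finite and has no nonzero abelian projection. -/
def IsTypeIIOne (N : VonNeumannAlgebra H) : Prop :=
  IsFinite N ∧ ∀ e, IsAbelianProjection N e → e = 0

/-- `N` is hyperfinite: it is the ultraweak closure of the union of an upward directed family of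
finite-dimensional `*`-subalgebras. -/
def IsHyperfinite (N : VonNeumannAlgebra H) : Prop :=
  ∃ F : Set (StarSubalgebra ℂ (H →L[ℂ] H)), F.Nonempty ∧ DirectedOn (· ≤ ·) F ∧
    (∀ A ∈ F, FiniteDimensional ℂ A) ∧
    @closure _ (ultraweak H) (⋃ A ∈ F, (A : Set (H →L[ℂ] H))) = (N : Set (H →L[ℂ] H))

/-- The operator on the Hilbert space direct sum `Hⁿ` given by a matrix of operators on `H`:
`(X ξ)ᵢ = ∑ⱼ Xᵢⱼ ξⱼ`. -/
def matrixOp {n : ℕ} (X : Matrix (Fin n) (Fin n) (H →L[ℂ] H)) :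
    PiLp 2 (fun _ : Fin n => H) →L[ℂ] PiLp 2 (fun _ : Fin n => H) :=
  (PiLp.continuousLinearEquiv 2 ℂ (fun _ : Fin n => H)).symm.toContinuousLinearMap ∘L
    ContinuousLinearMap.pi (fun i => ∑ j, X i j ∘L PiLp.proj 2 (fun _ : Fin n => H) j)

theorem matrixOp_apply {n : ℕ} (X : Matrix (Fin n) (Fin n) (H →L[ℂ] H))
    (ξ : PiLp 2 (fun _ : Fin n => H)) (i : Fin n) : matrixOp X ξ i = ∑ j, X i j (ξ j) := by
  simp [matrixOp]

/-- The norm of `Mₙ(N)`, as an algebra of operators on `Hⁿ`. -/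
def matrixNorm (N : VonNeumannAlgebra H) {n : ℕ}
    (X : Matrix (Fin n) (Fin n) N.toStarSubalgebra) : ℝ :=
  ‖matrixOp (X.map (fun x => (x : H →L[ℂ] H)))‖

variable {N : VonNeumannAlgebra H}
  (φ : N.toStarSubalgebra →ₗ[ℂ] N.toStarSubalgebra →ₗ[ℂ] N.toStarSubalgebra)

/-- The bilinear map `φ` is bounded. -/
def IsBoundedBilin : Prop :=
  ∃ C : ℝ, ∀ x y, ‖(φ x y : H →L[ℂ] H)‖ ≤ C * ‖(x : H →L[ℂ] H)‖ * ‖(y : H →L[ℂ] H)‖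

/-- The bilinear map `φ` is normal in each variable separately. -/
def IsSeparatelyNormal : Prop :=
  (∀ y, IsNormal N (fun x => φ x y)) ∧ ∀ x, IsNormal N (fun y => φ x y)

/-- The bilinear map `φ` on `N` is multimodular over the subalgebra `P` of `N`. -/
def IsMultimodular (P : VonNeumannAlgebra H) : Prop :=
  ∀ r : N.toStarSubalgebra, (r : H →L[ℂ] H) ∈ P → ∀ x y,
    φ (r * x) y = r * φ x y ∧ φ (x * r) y = φ x (r * y) ∧ φ x (y * r) = φ x y * r

/-- The `n`-th amplification of `φ`: `φₙ(X, Y)ᵢⱼ = ∑ₖ φ(Xᵢₖ, Yₖⱼ)`. -/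
def amplification (n : ℕ) (X Y : Matrix (Fin n) (Fin n) N.toStarSubalgebra) :
    Matrix (Fin n) (Fin n) N.toStarSubalgebra :=
  Matrix.of fun i j => ∑ k, φ (X i k) (Y k j)

/-- The bilinear map `φ` is completely bounded: its amplifications are uniformly bounded. -/
def IsCompletelyBounded : Prop :=
  ∃ C : ℝ, ∀ (n : ℕ) (X Y : Matrix (Fin n) (Fin n) N.toStarSubalgebra),
    matrixNorm N (amplification φ n X Y) ≤ C * matrixNorm N X * matrixNorm N Y

end Operators

section Tensor

variable {H : Type u} [NormedAddCommGroup H] [InnerProductSpace ℂ H] [CompleteSpace H]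
  {K : Type v} [NormedAddCommGroup K] [InnerProductSpace ℂ K] [CompleteSpace K]

/-- The Hilbert space tensor product: the completion of the algebraic tensor product in the inner
product with `⟪a ⊗ b, c ⊗ d⟫ = ⟪a, c⟫ ⟪b, d⟫`. -/
abbrev HilbertTensor (H : Type u) [NormedAddCommGroup H] [InnerProductSpace ℂ H]
    (K : Type v) [NormedAddCommGroup K] [InnerProductSpace ℂ K] : Type (max u v) :=
  UniformSpace.Completion (H ⊗[ℂ] K)

/-- The operator `a ⊗ b` on the Hilbert space tensor product. -/
def tensorOp (a : H →L[ℂ] H) (b : K →L[ℂ] K) : HilbertTensor H K →L[ℂ] HilbertTensor H K :=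
  (TensorProduct.mapL a b).completion

theorem tensorOp_tmul (a : H →L[ℂ] H) (b : K →L[ℂ] K) (ξ : H) (η : K) :
    tensorOp a b ((ξ ⊗ₜ[ℂ] η : H ⊗[ℂ] K) : HilbertTensor H K) =
      ((a ξ ⊗ₜ[ℂ] b η : H ⊗[ℂ] K) : HilbertTensor H K) := by
  simp [tensorOp]

/-- The von Neumann algebra tensor product: the von Neumann algebra generated by the operators
`a ⊗ b` with `a ∈ M` and `b ∈ S`. -/
def vnTensor (M : VonNeumannAlgebra H) (S : VonNeumannAlgebra K) :
    VonNeumannAlgebra (HilbertTensor H K) :=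
  generated {x | ∃ a ∈ M, ∃ b ∈ S, x = tensorOp a b}

theorem vnTensor_mono_left {R M : VonNeumannAlgebra H} (h : R ≤ M) (S : VonNeumannAlgebra K) :
    vnTensor R S ≤ vnTensor M S :=
  generated_mono fun _ ⟨a, ha, b, hb, hx⟩ => ⟨a, h ha, b, hb, hx⟩

end Tensor

end VNTensor

end

/-!
Write `N = M ⊗ S` and let `A` be one of the finite-dimensional `*`-algebras with dense union in `S`.
Let `N_A` be the algebra of the elements of `N` commuting with `1 ⊗ (A' ∩ S)` (`tensorLevel`).

*Bounds on `N_A`.* Since `S` has no abelian projections, neither has `A' ∩ S`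
(`NoAbelianProjection.relCommutant`), so `A' ∩ S` can be halved repeatedly (`exists_halving`) and
contains matrix units `f` of every size `2ᵏ` (`exists_matrixUnits`). The operators `r = 1 ⊗ f`
belong to `R ⊗ S` and commute with `N_A`. For matrices `X`, `Y` over `N_A`, put `x = ∑ Xᵢⱼ rᵢⱼ` and
`y = ∑ Yᵢⱼ rᵢⱼ`. Multimodularity gives `φ(x, y) = ∑ φₙ(X, Y)ᵢⱼ rᵢⱼ` and shows that the entries of
`φₙ(X, Y)` commute with the matrix units, so the norms of these three sums are those of the
matrices of coefficients (`IsMatrixUnits.norm_sum_le`, `IsMatrixUnits.norm_matrixOp_le`). Hence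
`φₙ` is bounded on `Mₙ(N_A)` by the bound of `φ`, for every `n`
(`matrixNorm_amplification_le_of_matrixUnits`).

*Passage to `N`.* The `N_A` are directed, and their union generates `N`, as it contains `M ⊗ 1` and
`1 ⊗ A` for every `A` (`inBicommutant_iSup_tensorLevel`). By a form of Kaplansky's density theorem
with the constant `2` (`exists_bounded_strong_approx`), a matrix over `N` is the strong limit of
matrices over the union with at most twice its norm. Separate normality allows passing to the limit
in one variable after the other, which costs a factor `4`
(`matrixNorm_amplification_le_of_dense`).
-/

open scoped TensorProduct

noncomputable section

namespace VNTensor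

/-! ### Square-zero elements of noncommutative corners -/

section SquareZero

variable {E : Type*} [NormedAddCommGroup E] [InnerProductSpace ℂ E] [CompleteSpace E]

theorem mem_of_commute {B : VonNeumannAlgebra E} {x : E →L[ℂ] E}
    (h : ∀ t ∈ B.commutant, Commute t x) : x ∈ B := by
  rw [← B.commutant_commutant, VonNeumannAlgebra.mem_commutant_iff]
  exact fun t ht => h t ht

theorem commute_of_mem {B : VonNeumannAlgebra E} {x t : E →L[ℂ] E} (hx : x ∈ B)
    (ht : t ∈ B.commutant) : Commute t x :=
  (VonNeumannAlgebra.mem_commutant_iff.1 ht x hx).symm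

theorem smul_mem_vonNeumannAlgebra {B : VonNeumannAlgebra E} {x : E →L[ℂ] E} (c : ℂ)
    (hx : x ∈ B) : c • x ∈ B :=
  mem_of_commute fun _ ht => (commute_of_mem hx ht).smul_right c

theorem cfc_mem_vonNeumannAlgebra {B : VonNeumannAlgebra E} {x : E →L[ℂ] E} (f : ℝ → ℝ)
    (hx : x ∈ B) (hsa : IsSelfAdjoint x) : cfc f x ∈ B :=
  mem_of_commute fun _ ht =>
    (Commute.cfc (commute_of_mem hx ht).symm
      (by rw [hsa.star_eq]; exact (commute_of_mem hx ht).symm) f).symm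

theorem isUnit_of_isSelfAdjoint_of_bounded_below {T : E →L[ℂ] E} (hT : IsSelfAdjoint T) {c : ℝ}
    (hc : 0 < c) (hlow : ∀ ξ, c * ‖ξ‖ ≤ ‖T ξ‖) : IsUnit T := by
  have hunit : IsUnit (T * T) := by
    have hc2 : 0 < c ^ 2 := by positivity
    refine ContinuousLinearMap.isUnit_of_forall_le_norm_inner_map _
      (c := ⟨c ^ 2, hc2.le⟩) hc2 fun ξ => ?_
    have h1 : inner ℂ ((T * T) ξ) ξ = inner ℂ (T ξ) (T ξ) := hT.isSymmetric (T ξ) ξ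
    rw [h1, inner_self_eq_norm_sq_to_K, norm_pow, RCLike.norm_ofReal, abs_norm]
    calc ‖ξ‖ ^ 2 * c ^ 2 = (c * ‖ξ‖) ^ 2 := by ring
      _ ≤ ‖T ξ‖ ^ 2 := by gcongr; exact hlow ξ
  exact ((Commute.refl T).isUnit_mul_iff.1 hunit).1

/-- A self-adjoint operator has approximate eigenvectors. -/
theorem exists_approx_eigenvector [Nontrivial E] {T : E →L[ℂ] E} (hT : IsSelfAdjoint T) {c : ℝ}
    (hc : 0 < c) : ∃ r : ℝ, ∃ ξ : E, ‖(r : ℂ) • ξ - T ξ‖ < c * ‖ξ‖ := by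
  obtain ⟨z, hz⟩ := spectrum.nonempty T
  by_contra! hcon
  refine hz ?_
  rw [hT.mem_spectrum_eq_re hz]
  refine isUnit_of_isSelfAdjoint_of_bounded_below (IsSelfAdjoint.sub ?_ hT) hc fun ξ => ?_
  · exact IsSelfAdjoint.algebraMap _ (by simp [IsSelfAdjoint])
  · simpa [Algebra.algebraMap_eq_smul_one] using hcon z.re ξ

/-- A commutator `[h, x]` with `h` self-adjoint is not bounded below as a quadratic form on a
nonzero closed subspace invariant under `h`: it almost vanishes at approximate eigenvectors. -/
theorem not_commutator_bounded_below {K : Submodule ℂ E} (hKc : IsClosed (K : Set E))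
    (hK0 : K ≠ ⊥) {h x : E →L[ℂ] E} (hsa : IsSelfAdjoint h) (hh : ∀ ξ ∈ K, h ξ ∈ K)
    {ε : ℝ} (hε : 0 < ε)
    (hpos : ∀ ξ ∈ K, ε * ‖ξ‖ ^ 2 ≤ ‖inner ℂ ((h * x - x * h) ξ) ξ‖) : False := by
  have : CompleteSpace K := hKc.completeSpace_coe
  have : Nontrivial K := (Submodule.nontrivial_iff_ne_bot).2 hK0
  obtain ⟨k, hk⟩ : ∃ k : K →L[ℂ] K, ∀ ξ : K, (k ξ : E) = h ξ :=
    ⟨(h.comp K.subtypeL).codRestrict K fun ξ => hh ξ ξ.2, fun _ => rfl⟩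
  have hsym : ∀ ξ η : E, inner ℂ (h ξ) η = inner ℂ ξ (h η) := fun ξ η => hsa.isSymmetric ξ η
  have hksa : IsSelfAdjoint k := by
    rw [ContinuousLinearMap.isSelfAdjoint_iff_isSymmetric]
    intro ξ η
    simp only [ContinuousLinearMap.coe_coe, Submodule.coe_inner, hk, hsym]
  obtain ⟨r, ζ, hζ⟩ := exists_approx_eigenvector hksa
    (show 0 < ε / (2 * ‖x‖ + 1) by positivity)
  obtain ⟨ξ, hξK⟩ := ζ
  have hζ' : ‖(r : ℂ) • ξ - h ξ‖ < ε / (2 * ‖x‖ + 1) * ‖ξ‖ := by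
    have e1 := hk ⟨ξ, hξK⟩
    rw [← e1]
    exact hζ
  set τ := (r : ℂ) • ξ - h ξ with hτ
  have hξ : 0 < ‖ξ‖ := by
    by_contra! h0
    have h0' : ‖ξ‖ = 0 := le_antisymm h0 (norm_nonneg _)
    rw [h0', mul_zero] at hζ'
    exact absurd hζ' (not_lt.2 (norm_nonneg _))
  have e1 : inner ℂ ((h * x - x * h) ξ) ξ = - inner ℂ (x ξ) τ + inner ℂ (x τ) ξ := by
    have e2 : ∀ ζ, (h * x - x * h) ζ = h (x ζ) - x (h ζ) := fun _ => rfl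
    simp only [e2, hτ, map_sub, map_smul,
      inner_sub_left, inner_sub_right, inner_smul_left, inner_smul_right, hsym,
      Complex.conj_ofReal]
    ring
  have h1 := hpos ξ hξK
  rw [e1] at h1
  have h2 : ‖inner ℂ (x ξ) τ‖ ≤ ‖x‖ * ‖ξ‖ * ‖τ‖ :=
    (norm_inner_le_norm _ _).trans (mul_le_mul_of_nonneg_right (x.le_opNorm _) (norm_nonneg _))
  have h3 : ‖inner ℂ (x τ) ξ‖ ≤ ‖x‖ * ‖τ‖ * ‖ξ‖ :=
    (norm_inner_le_norm _ _).trans (mul_le_mul_of_nonneg_right (x.le_opNorm _) (norm_nonneg _))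
  have h4 := norm_add_le (- inner ℂ (x ξ) τ) (inner ℂ (x τ) ξ)
  rw [norm_neg] at h4
  rw [div_mul_eq_mul_div, lt_div_iff₀ (by positivity)] at hζ'
  have h5 : ε * ‖ξ‖ ≤ 2 * ‖x‖ * ‖τ‖ := by
    refine le_of_mul_le_mul_right ?_ hξ
    nlinarith
  nlinarith [norm_nonneg τ]

/-- A noncommutative corner `eBe` contains a nonzero element of square zero. Otherwise `uv = 0`
forces `u (eBe) v = 0`; taking `u, v` to be the parts of a commutator `i[h, x]` above and below a
small `ε > 0` makes this commutator bounded below on an invariant subspace. -/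
theorem exists_mul_self_eq_zero_of_isSelfAdjoint {B : VonNeumannAlgebra E} {e h x : E →L[ℂ] E}
    (heB : e ∈ B) (he : IsStarProjection e) (hB : h ∈ B) (xB : x ∈ B)
    (hsa : IsSelfAdjoint h) (xsa : IsSelfAdjoint x) (heh : e * h = h) (hex : e * x = x)
    (hne : h * x ≠ x * h) :
    ∃ z ∈ B, z ≠ 0 ∧ z * z = 0 ∧ e * z = z ∧ z * e = z := by
  by_contra! hcon
  replace hcon : ∀ z ∈ B, z * z = 0 → e * z = z → z * e = z → z = 0 := by
    intro z h1 h2 h3 h4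
    by_contra h5
    exact hcon z h1 h5 h2 h3 h4
  have hhe : h * e = h := by
    have := congrArg star heh
    rwa [star_mul, hsa.star_eq, he.isSelfAdjoint.star_eq] at this
  have hxe : x * e = x := by
    have := congrArg star hex
    rwa [star_mul, xsa.star_eq, he.isSelfAdjoint.star_eq] at this
  -- the sign of `c` makes a positive number belong to the spectrum of the commutator
  obtain ⟨c, hc0, hcs, t, ht, htpos⟩ : ∃ c : ℂ, ‖c‖ = 1 ∧ star c = -c ∧
      ∃ t ∈ spectrum ℝ (c • (h * x - x * h)), 0 < t := by
    have hd0 : Complex.I • (h * x - x * h) ≠ 0 := by simpa [sub_eq_zero] using hne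
    have hdsa : IsSelfAdjoint (Complex.I • (h * x - x * h)) := by
      rw [IsSelfAdjoint, star_smul, star_sub, star_mul, star_mul, hsa.star_eq, xsa.star_eq]
      simp only [Complex.star_def, Complex.conj_I, neg_smul, ← smul_neg, neg_sub]
    obtain ⟨t, ht, ht0⟩ : ∃ t ∈ spectrum ℝ (Complex.I • (h * x - x * h)), t ≠ 0 := by
      by_contra! h0
      exact hd0 (CFC.eq_zero_of_spectrum_subset_zero (R := ℝ) _ (fun t ht => h0 t ht) hdsa)
    rcases lt_or_gt_of_ne ht0 with h1 | h1
    · refine ⟨-Complex.I, by simp, by simp, -t, ?_, by linarith⟩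
      rw [neg_smul, ← spectrum.neg_eq]
      simpa using ht
    · exact ⟨Complex.I, by simp, by simp, t, ht, h1⟩
  set d := c • (h * x - x * h) with hd
  have hdsa : IsSelfAdjoint d := by
    rw [hd, IsSelfAdjoint, star_smul, star_sub, star_mul, star_mul, hsa.star_eq, xsa.star_eq, hcs,
      neg_smul, ← smul_neg, neg_sub]
  have hdB : d ∈ B := smul_mem_vonNeumannAlgebra _ (sub_mem (mul_mem hB xB) (mul_mem xB hB))
  have hde : d * e = d := by
    rw [hd, smul_mul_assoc, sub_mul, mul_assoc, mul_assoc, hxe, hhe]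
  have hed : e * d = d := by
    rw [hd, mul_smul_comm, mul_sub, ← mul_assoc, ← mul_assoc, hex, heh]
  obtain ⟨ε, hε, hεt⟩ : ∃ ε : ℝ, 0 < ε ∧ ε < t := ⟨t / 2, by positivity, by linarith⟩
  set u := cfc (fun s : ℝ => max (s - ε) 0) d with hu
  set v := cfc (fun s : ℝ => max (ε - s) 0) d with hv
  have huB : u ∈ B := cfc_mem_vonNeumannAlgebra _ hdB hdsa
  have hvB : v ∈ B := cfc_mem_vonNeumannAlgebra _ hdB hdsa
  have husa : IsSelfAdjoint u := cfc_predicate _ d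
  have hu0 : u ≠ 0 := by
    intro h0
    have h2 : max (t - ε) 0 ∈ spectrum ℝ u := by
      rw [hu, cfc_map_spectrum (R := ℝ) (fun s : ℝ => max (s - ε) 0) d hdsa]
      exact ⟨t, ht, rfl⟩
    have : Nontrivial (E →L[ℂ] E) := ⟨_, _, hne⟩
    rw [h0, spectrum.zero_eq] at h2
    have h3 : max (t - ε) 0 = 0 := h2
    have h4 := le_max_left (t - ε) 0
    linarith
  have hgc : Continuous fun s : ℝ => max (s - ε) 0 / max s ε :=
    Continuous.div (by fun_prop) (by fun_prop) fun s => (lt_max_of_lt_right hε).ne'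
  have hue : u * e = u := by
    have : u = cfc (fun s : ℝ => max (s - ε) 0 / max s ε) d * d := by
      nth_rw 2 [← cfc_id ℝ d]
      rw [hu, ← cfc_mul _ _ d hgc.continuousOn continuousOn_id]
      congr 1
      ext s
      rcases le_total s ε with h1 | h1
      · simp [h1]
      · rw [max_eq_left h1, id, div_mul_cancel₀ _ (hε.trans_le h1).ne']
    rw [this, mul_assoc, hde]
  have heu : e * u = u := by
    have := congrArg star hue
    rwa [star_mul, husa.star_eq, he.isSelfAdjoint.star_eq] at this
  have hve : Commute v e := by
    have h1 : Commute d e := by rw [Commute, SemiconjBy, hde, hed]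
    exact Commute.cfc h1 (by rwa [hdsa.star_eq]) _
  have hvu : v * u = 0 := by
    rw [hu, hv, ← cfc_mul _ _ d]
    rw [← cfc_const_zero ℝ d]
    congr 1
    ext s
    rcases le_total s ε with h1 | h1 <;> simp [h1]
  have hdiff : d - ε • 1 = u - v := by
    rw [hu, hv, ← cfc_sub _ _ d]
    nth_rw 1 [← cfc_id' ℝ d]
    rw [← Algebra.algebraMap_eq_smul_one, ← cfc_const ε d, ← cfc_sub _ _ d]
    congr 1
    ext s
    rcases le_total s ε with h1 | h1 <;> simp [h1]
  have huv : u * v = 0 := by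
    have hvsa : IsSelfAdjoint v := cfc_predicate _ d
    have := congrArg star hvu
    rwa [star_mul, husa.star_eq, hvsa.star_eq, star_zero] at this
  have hzero : ∀ y ∈ B, e * y = y → v * y * u = 0 := by
    intro y hy hey
    have h1 : e * (v * y * u) = v * y * u := by
      rw [← mul_assoc, ← mul_assoc, ← hve.eq, mul_assoc v, hey]
    have h2 : (v * y * u) * e = v * y * u := by rw [mul_assoc, hue]
    refine hcon _ (mul_mem (mul_mem hvB hy) huB) ?_ h1 h2
    calc v * y * u * (v * y * u) = v * y * (u * v) * (y * u) := by simp only [mul_assoc]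
      _ = 0 := by rw [huv]; simp
  -- the closed subspace generated by `(eBe) u E`
  let K₀ : Submodule ℂ E := Submodule.span ℂ {ζ | ∃ y ∈ B, e * y = y ∧ ∃ ξ, ζ = y (u ξ)}
  refine not_commutator_bounded_below (K := K₀.topologicalClosure) (h := h) (x := x) (ε := ε)
    K₀.isClosed_topologicalClosure ?_ hsa ?_ hε ?_
  · intro hbot
    refine hu0 ?_
    ext ξ
    have : u ξ ∈ K₀.topologicalClosure := by
      refine K₀.le_topologicalClosure (Submodule.subset_span ⟨e, heB, he.isIdempotentElem, ξ, ?_⟩)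
      exact (congrArg (fun T : E →L[ℂ] E => T ξ) heu).symm
    rw [hbot] at this
    simpa using this
  · have hle : K₀ ≤ K₀.topologicalClosure.comap (h : E →ₗ[ℂ] E) := by
      rw [Submodule.span_le]
      rintro _ ⟨y, hy, hey, ξ, rfl⟩
      exact K₀.le_topologicalClosure (Submodule.subset_span
        ⟨h * y, mul_mem hB hy, by rw [← mul_assoc, heh], ξ, rfl⟩)
    exact Submodule.topologicalClosure_minimal _ hle
      (K₀.isClosed_topologicalClosure.preimage h.continuous)
  · intro ζ hζ
    have hv0 : v ζ = 0 := by
      have hle : K₀ ≤ LinearMap.ker (v : E →ₗ[ℂ] E) := by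
        rw [Submodule.span_le]
        rintro _ ⟨y, hy, hey, ξ, rfl⟩
        exact congrArg (fun T : E →L[ℂ] E => T ξ) (hzero y hy hey)
      exact Submodule.topologicalClosure_minimal _ hle
        (isClosed_singleton.preimage v.continuous) hζ
    have hupos : 0 ≤ u := cfc_nonneg fun s _ => le_max_right _ _
    have h1 : (inner ℂ (d ζ) ζ : ℂ) = ε * ‖ζ‖ ^ 2 + inner ℂ (u ζ) ζ := by
      have h2 : d ζ = ε • ζ + u ζ := by
        have := congrArg (fun T : E →L[ℂ] E => T ζ) hdiff
        simp only [sub_apply, hv0, sub_zero, smul_apply, one_apply_eq_self] at this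
        rw [← this]; abel
      rw [h2, inner_add_left, ← Complex.coe_smul, inner_smul_left, inner_self_eq_norm_sq_to_K]
      simp
    have h2 := ((ContinuousLinearMap.nonneg_iff_isPositive u).1 hupos).re_inner_nonneg_left ζ
    have h3 : ‖inner ℂ ((h * x - x * h) ζ) ζ‖ = ‖(inner ℂ (d ζ) ζ : ℂ)‖ := by
      rw [hd, smul_apply, inner_smul_left, norm_mul, RCLike.norm_conj, hc0, one_mul]
    rw [h3, h1]
    refine le_trans ?_ (Complex.re_le_norm _)
    simp only [Complex.add_re]
    have h4 : ((ε : ℂ) * (‖ζ‖ : ℂ) ^ 2).re = ε * ‖ζ‖ ^ 2 := by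
      rw [← Complex.ofReal_pow, ← Complex.ofReal_mul, Complex.ofReal_re]
    rw [h4]
    exact le_add_of_nonneg_right h2

/-- A noncommutative corner contains a nonzero element of square zero: one of the commutators of the
real and imaginary parts of two noncommuting elements does not vanish. -/
theorem exists_mul_self_eq_zero {B : VonNeumannAlgebra E} {e x y : E →L[ℂ] E}
    (heB : e ∈ B) (he : IsStarProjection e) (xB : x ∈ B) (yB : y ∈ B)
    (hne : (e * x * e) * (e * y * e) ≠ (e * y * e) * (e * x * e)) :
    ∃ z ∈ B, z ≠ 0 ∧ z * z = 0 ∧ e * z = z ∧ z * e = z := by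
  by_contra hcon
  -- self-adjoint elements of the corner commute
  have hsa : ∀ a ∈ B, ∀ b ∈ B, IsSelfAdjoint a → IsSelfAdjoint b →
      Commute (e * a * e) (e * b * e) := by
    intro a ha b hb ha' hb'
    by_contra h0
    have hsa' : ∀ a, IsSelfAdjoint a → IsSelfAdjoint (e * a * e) := fun a ha => by
      have := ha.conjugate e
      rwa [he.isSelfAdjoint.star_eq] at this
    have hee : ∀ a, e * (e * a * e) = e * a * e := fun a => by
      rw [← mul_assoc, ← mul_assoc, he.isIdempotentElem.eq]
    exact hcon (exists_mul_self_eq_zero_of_isSelfAdjoint heB he (mul_mem (mul_mem heB ha) heB)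
      (mul_mem (mul_mem heB hb) heB) (hsa' a ha') (hsa' b hb') (hee a) (hee b) h0)
  have hdecomp : ∀ a ∈ B, ∃ a₁ ∈ B, ∃ a₂ ∈ B, IsSelfAdjoint a₁ ∧ IsSelfAdjoint a₂ ∧
      a = a₁ + Complex.I • a₂ := by
    intro a ha
    refine ⟨realPart a, ?_, imaginaryPart a, ?_, (realPart a).2, (imaginaryPart a).2,
      (realPart_add_I_smul_imaginaryPart a).symm⟩
    · rw [realPart_apply_coe, ← Complex.coe_smul]
      exact smul_mem_vonNeumannAlgebra _ (add_mem ha (star_mem ha))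
    · rw [imaginaryPart_apply_coe, ← Complex.coe_smul]
      exact smul_mem_vonNeumannAlgebra _
        (smul_mem_vonNeumannAlgebra _ (sub_mem ha (star_mem ha)))
  obtain ⟨x₁, hx₁, x₂, hx₂, sx₁, sx₂, rfl⟩ := hdecomp x xB
  obtain ⟨y₁, hy₁, y₂, hy₂, sy₁, sy₂, rfl⟩ := hdecomp y yB
  refine hne ?_
  have hsplit : ∀ a b : E →L[ℂ] E,
      e * (a + Complex.I • b) * e = e * a * e + Complex.I • (e * b * e) := fun a b => by
    simp only [mul_add, add_mul, mul_smul_comm, smul_mul_assoc]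
  rw [hsplit, hsplit]
  exact (((hsa x₁ hx₁ y₁ hy₁ sx₁ sy₁).add_right
    ((hsa x₁ hx₁ y₂ hy₂ sx₁ sy₂).smul_right _)).add_left
    (((hsa x₂ hx₂ y₁ hy₁ sx₂ sy₁).add_right
    ((hsa x₂ hx₂ y₂ hy₂ sx₂ sy₂).smul_right _)).smul_left _)).eq

end SquareZero

/-! ### Polar decomposition, partial isometries and halving -/

section Halving

variable {E : Type*} [NormedAddCommGroup E] [InnerProductSpace ℂ E] [CompleteSpace E]

open Filter Topology

theorem norm_abs_apply (z : E →L[ℂ] E) (ξ : E) : ‖CFC.abs z ξ‖ = ‖z ξ‖ := by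
  have h1 : ∀ T : E →L[ℂ] E, (‖T ξ‖ : ℂ) ^ 2 = inner ℂ ((star T * T) ξ) ξ := fun T => by
    have : inner ℂ ((star T * T) ξ) ξ = inner ℂ (T ξ) (T ξ) :=
      ContinuousLinearMap.adjoint_inner_left T ξ (T ξ)
    rw [this, inner_self_eq_norm_sq_to_K]; rfl
  have hsa : star (CFC.abs z) = CFC.abs z := (CFC.abs_nonneg z).isSelfAdjoint.star_eq
  have h2 : (‖CFC.abs z ξ‖ : ℂ) ^ 2 = (‖z ξ‖ : ℂ) ^ 2 := by
    rw [h1, h1, hsa, CFC.abs_mul_abs]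
  have h3 : ‖CFC.abs z ξ‖ ^ 2 = ‖z ξ‖ ^ 2 := by exact_mod_cast h2
  exact (sq_eq_sq₀ (norm_nonneg _) (norm_nonneg _)).1 h3

/-- The kernel of a self-adjoint operator is the orthogonal complement of its range, so operators
are determined by their values on both. -/
theorem eq_of_eq_on_range_of_eq_on_ker {a T₁ T₂ : E →L[ℂ] E} (ha : IsSelfAdjoint a)
    (h1 : T₁ * a = T₂ * a) (h2 : ∀ η, a η = 0 → T₁ η = T₂ η) : T₁ = T₂ := by
  let U := (LinearMap.range (a : E →ₗ[ℂ] E)).topologicalClosure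
  have : CompleteSpace U := (Submodule.isClosed_topologicalClosure _).completeSpace_coe
  have hU : ∀ ζ ∈ U, T₁ ζ = T₂ ζ := by
    intro ζ hζ
    have hle : LinearMap.range (a : E →ₗ[ℂ] E) ≤ LinearMap.eqLocus (T₁ : E →ₗ[ℂ] E) T₂ := by
      rintro _ ⟨ξ, rfl⟩
      exact congrArg (fun T : E →L[ℂ] E => T ξ) h1
    exact Submodule.topologicalClosure_minimal _ hle (isClosed_eq T₁.continuous T₂.continuous) hζ
  ext ζ
  have h3 : a (ζ - U.starProjection ζ) = 0 := by
    refine ext_inner_right ℂ fun η => ?_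
    have h4 : inner ℂ (a (ζ - U.starProjection ζ)) η = inner ℂ (ζ - U.starProjection ζ) (a η) :=
      ha.isSymmetric _ _
    rw [h4, inner_zero_left]
    exact Submodule.starProjection_inner_eq_zero _ _
      (Submodule.le_topologicalClosure _ (LinearMap.mem_range_self _ η))
  have h5 := h2 _ h3
  rw [map_sub, map_sub, hU _ (Submodule.starProjection_apply_mem _ _)] at h5
  exact sub_left_injective h5

/-- The partial isometry of the polar decomposition of `z ∈ B` lies in `B`; its initial and final
spaces are the closures of the ranges of `z*` and `z`. -/
theorem exists_polar {B : VonNeumannAlgebra E} {z : E →L[ℂ] E} (hz : z ∈ B) :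
    ∃ w ∈ B, w * star w * w = w ∧ w * CFC.abs z = z ∧
      (∀ t : E →L[ℂ] E, z * t = 0 → w * t = 0) ∧ ∀ t : E →L[ℂ] E, t * z = 0 → t * w = 0 := by
  set a := CFC.abs z with ha
  have hasa : IsSelfAdjoint a := (CFC.abs_nonneg z).isSelfAdjoint
  have hna : ∀ ξ, ‖a ξ‖ = ‖z ξ‖ := norm_abs_apply z
  have hker : ∀ ξ, a ξ = 0 ↔ z ξ = 0 := fun ξ => by
    rw [← norm_eq_zero, hna, norm_eq_zero]
  let U := (LinearMap.range (a : E →ₗ[ℂ] E)).topologicalClosure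
  have : CompleteSpace U := (Submodule.isClosed_topologicalClosure _).completeSpace_coe
  obtain ⟨w, hw1, hw2⟩ : ∃ w : E →L[ℂ] E, (∀ ξ, w (a ξ) = z ξ) ∧ ∀ η, a η = 0 → w η = 0 := by
    let e : E →ₗ[ℂ] U := (a : E →ₗ[ℂ] E).codRestrict U fun ξ =>
      Submodule.le_topologicalClosure _ (LinearMap.mem_range_self _ ξ)
    have hdense : DenseRange e := by
      intro ζ
      rw [closure_subtype]
      have : (Subtype.val '' Set.range e : Set E) = LinearMap.range (a : E →ₗ[ℂ] E) := by
        ext ζ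
        constructor
        · rintro ⟨_, ⟨ξ, rfl⟩, rfl⟩
          exact ⟨ξ, rfl⟩
        · rintro ⟨ξ, rfl⟩
          exact ⟨e ξ, ⟨ξ, rfl⟩, rfl⟩
      rw [this]
      exact ζ.2
    have hnorm : ∃ C, ∀ ξ, ‖(z : E →ₗ[ℂ] E) ξ‖ ≤ C * ‖e ξ‖ :=
      ⟨1, fun ξ => by rw [one_mul]; exact (hna ξ).ge⟩
    refine ⟨((z : E →ₗ[ℂ] E).extendOfNorm e).comp U.orthogonalProjectionOnto, fun ξ => ?_,
      fun η hη => ?_⟩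
    · have h1 : U.orthogonalProjectionOnto (a ξ) = e ξ :=
        Submodule.orthogonalProjectionOnto_mem_subspace_eq_self (e ξ)
      rw [ContinuousLinearMap.comp_apply, h1, LinearMap.extendOfNorm_eq hdense hnorm]
      rfl
    · have h1 : U.orthogonalProjectionOnto η = 0 := by
        rw [Submodule.orthogonalProjectionOnto_eq_zero_iff, Submodule.orthogonal_closure]
        rintro _ ⟨ξ, rfl⟩
        have : inner ℂ (a ξ) η = inner ℂ ξ (a η) := hasa.isSymmetric ξ η
        rw [ContinuousLinearMap.coe_coe, this, hη, inner_zero_right]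
      rw [ContinuousLinearMap.comp_apply, h1, map_zero]
  have hwa : w * a = z := by ext ξ; exact hw1 ξ
  have hwwa : star w * w * a = a := by
    have h1 : star z * w = a := by
      refine eq_of_eq_on_range_of_eq_on_ker hasa ?_ fun η hη => ?_
      · rw [mul_assoc, hwa, ← CFC.abs_mul_abs]
      · rw [hη, mul_apply_eq_comp, hw2 η hη, map_zero]
    have h2 := congrArg star h1
    rwa [star_mul, star_star, hasa.star_eq, ← hwa, ← mul_assoc] at h2
  refine ⟨w, mem_of_commute fun t ht => ?_, ?_, hwa, fun t ht => ?_, fun t ht => ?_⟩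
  · have htz : Commute t z := commute_of_mem hz ht
    have hta : Commute t a :=
      (Commute.cfcAbs_left htz.symm (commute_of_mem hz (star_mem ht)).symm).symm
    refine eq_of_eq_on_range_of_eq_on_ker hasa ?_ fun η hη => ?_
    · rw [mul_assoc, hwa, htz.eq, mul_assoc, hta.eq, ← mul_assoc, hwa]
    · have h1 : a (t η) = 0 := by
        have := congrArg (fun T : E →L[ℂ] E => T η) hta.eq
        rw [mul_apply_eq_comp, mul_apply_eq_comp] at this
        rw [← this, hη, map_zero]
      rw [mul_apply_eq_comp, mul_apply_eq_comp]
      rw [hw2 η hη, hw2 _ h1, map_zero]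
  · refine eq_of_eq_on_range_of_eq_on_ker hasa ?_ fun η hη => ?_
    · rw [mul_assoc w, mul_assoc w, hwwa]
    · rw [mul_apply_eq_comp, mul_apply_eq_comp]
      rw [hw2 η hη, map_zero, map_zero]
  · ext ξ
    refine hw2 _ ((hker _).2 ?_)
    exact congrArg (fun T : E →L[ℂ] E => T ξ) ht
  · refine eq_of_eq_on_range_of_eq_on_ker hasa ?_ fun η hη => ?_
    · rw [mul_assoc, hwa, ht, zero_mul]
    · rw [mul_apply_eq_comp, hw2 η hη, map_zero]; rfl

theorem exists_strong_limit {ι : Type*} {l : Filter ι} [l.NeBot] {T : ι → E →L[ℂ] E} {C : ℝ}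
    (hC : ∀ i, ‖T i‖ ≤ C) (h : ∀ ξ, Cauchy (map (fun i => T i ξ) l)) :
    ∃ V : E →L[ℂ] E, ∀ ξ, Tendsto (fun i => T i ξ) l (𝓝 (V ξ)) := by
  choose f hf using fun ξ => CompleteSpace.complete (h ξ)
  refine ⟨LinearMap.mkContinuous ⟨⟨f, fun ξ η => ?_⟩, fun c ξ => ?_⟩ C fun ξ => ?_, hf⟩
  · refine tendsto_nhds_unique (hf (ξ + η)) ?_
    simpa using Tendsto.add (hf ξ) (hf η)
  · refine tendsto_nhds_unique (hf (c • ξ)) ?_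
    simpa using Tendsto.const_smul (hf ξ) c
  · refine le_of_tendsto (Tendsto.norm (hf ξ)) (Eventually.of_forall fun i => ?_)
    exact (T i).le_of_opNorm_le (hC i) ξ

theorem tendsto_mul_apply {ι : Type*} {l : Filter ι} {T S : ι → E →L[ℂ] E} {T₀ S₀ : E →L[ℂ] E}
    {C : ℝ} (hC : ∀ i, ‖T i‖ ≤ C) (hT : ∀ ξ, Tendsto (fun i => T i ξ) l (𝓝 (T₀ ξ)))
    (hS : ∀ ξ, Tendsto (fun i => S i ξ) l (𝓝 (S₀ ξ))) (ξ : E) :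
    Tendsto (fun i => (T i * S i) ξ) l (𝓝 ((T₀ * S₀) ξ)) := by
  have h1 : Tendsto (fun i => T i (S i ξ - S₀ ξ)) l (𝓝 0) := by
    have h2 : Tendsto (fun i => C * ‖S i ξ - S₀ ξ‖) l (𝓝 0) := by
      simpa using (((hS ξ).sub_const (S₀ ξ)).norm).const_mul C
    exact squeeze_zero_norm (fun i => (T i).le_of_opNorm_le (hC i) _) h2
  have h3 := h1.add (hT (S₀ ξ))
  simpa using h3

theorem norm_le_one_of_partialIsometry {v : E →L[ℂ] E} (hv : v * star v * v = v) : ‖v‖ ≤ 1 := by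
  have h1 : ‖star v * v‖ * ‖star v * v‖ = ‖star v * v‖ := by
    have : star (star v * v) * (star v * v) = star v * v := by
      rw [star_mul, star_star, mul_assoc, ← mul_assoc v, hv]
    rw [← CStarRing.norm_star_mul_self, this]
  rw [CStarRing.norm_star_mul_self] at h1
  by_contra! h2
  have h3 : 1 < ‖v‖ * ‖v‖ := one_lt_mul_of_lt_of_le h2 h2.le
  nlinarith

/-- A family of partial isometries, directed by restriction, converges strongly. -/
theorem exists_strong_limit_of_partialIsometry {ι : Type*} {l : Filter ι} [l.NeBot]
    {T : ι → E →L[ℂ] E} (hT : ∀ i, T i * star (T i) * T i = T i)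
    (hl : ∀ i, ∀ᶠ j in l, T i * star (T i) * T j = T i) :
    ∃ V : E →L[ℂ] E, ∀ ξ, Tendsto (fun i => T i ξ) l (𝓝 (V ξ)) := by
  have hn : ∀ i, ‖T i‖ ≤ 1 := fun i => norm_le_one_of_partialIsometry (hT i)
  refine exists_strong_limit hn fun ξ => ?_
  have : Nonempty ι := l.nonempty_of_neBot
  have hbdd : BddAbove (Set.range fun i => ‖T i ξ‖ ^ 2) := by
    refine ⟨‖ξ‖ ^ 2, ?_⟩
    rintro _ ⟨i, rfl⟩
    have := (T i).le_of_opNorm_le (hn i) ξ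
    rw [one_mul] at this
    dsimp only
    gcongr
  -- Pythagoras: `T j ξ - T i ξ` is orthogonal to `T i ξ`
  have hpyth : ∀ i j, T i * star (T i) * T j = T i →
      ‖T j ξ - T i ξ‖ ^ 2 = ‖T j ξ‖ ^ 2 - ‖T i ξ‖ ^ 2 := by
    intro i j hij
    have h1 : inner ℂ (T j ξ) (T i ξ) = inner ℂ (T i ξ) (T i ξ) := by
      have h2 : inner ℂ ((T i * star (T i) * T j) ξ) (T i ξ) =
          inner ℂ (T j ξ) ((T i * star (T i) * T i) ξ) := by
        have e1 : inner ℂ ((T i * star (T i) * T j) ξ) (T i ξ) =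
            inner ℂ (star (T i) (T j ξ)) (star (T i) (T i ξ)) :=
          (ContinuousLinearMap.adjoint_inner_right (T i) _ _).symm
        have e2 : inner ℂ (T j ξ) ((T i * star (T i) * T i) ξ) =
            inner ℂ (star (T i) (T j ξ)) (star (T i) (T i ξ)) :=
          (ContinuousLinearMap.adjoint_inner_left (T i) _ _).symm
        rw [e1, e2]
      rw [hij, hT] at h2
      exact h2.symm
    have h3 : RCLike.re (inner ℂ (T j ξ) (T i ξ)) = ‖T i ξ‖ ^ 2 := by
      rw [h1]; exact inner_self_eq_norm_sq _
    rw [@norm_sub_sq ℂ, h3]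
    ring
  rw [Metric.cauchy_iff]
  refine ⟨inferInstance, fun ε hε => ?_⟩
  obtain ⟨N, hN⟩ := exists_lt_of_lt_ciSup
    (show (⨆ i, ‖T i ξ‖ ^ 2) - (ε / 2) ^ 2 < ⨆ i, ‖T i ξ‖ ^ 2 by
      have : 0 < (ε / 2) ^ 2 := by positivity
      linarith)
  have hclose : ∀ j, T N * star (T N) * T j = T N → ‖T j ξ - T N ξ‖ < ε / 2 := by
    intro j hj
    have h1 := hpyth N j hj
    have h2 := le_ciSup hbdd j
    refine lt_of_pow_lt_pow_left₀ 2 (by positivity) ?_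
    linarith
  refine ⟨_, image_mem_map (hl N), ?_⟩
  rintro _ ⟨i, hi, rfl⟩ _ ⟨j, hj, rfl⟩
  have h1 := hclose i hi
  have h2 := hclose j hj
  rw [← dist_eq_norm] at h1 h2
  have := dist_triangle_right (T i ξ) (T j ξ) (T N ξ)
  linarith

/-- `B` has no nonzero abelian projection. -/
def NoAbelianProjection (B : VonNeumannAlgebra E) : Prop :=
  ∀ e, IsAbelianProjection B e → e = 0

/-- The partial isometries of `B` with orthogonal initial and final spaces, encoded by `v v* v = v`
and `v² = 0`. -/
def nilpotentPartialIsometries (B : VonNeumannAlgebra E) : Set (E →L[ℂ] E) :=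
  {v | v ∈ B ∧ v * star v * v = v ∧ v * v = 0}

/-- `w` restricts to the partial isometry `v`, and so does `w*` to `v*`. -/
def PartialIsometryLE (v w : E →L[ℂ] E) : Prop :=
  w * (star v * v) = v ∧ v * star v * w = v

theorem partialIsometryLE_trans {u v w : E →L[ℂ] E} (hu : u * star u * u = u)
    (h1 : PartialIsometryLE u v) (h2 : PartialIsometryLE v w) : PartialIsometryLE u w := by
  obtain ⟨a1, a2⟩ := h1
  obtain ⟨b1, b2⟩ := h2
  have a1' : star u = star u * u * star v := by
    conv_lhs => rw [← a1]
    simp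
  have a2' : star u = star v * (u * star u) := by
    conv_lhs => rw [← a2]
    simp
  have c1 : star u * u = star v * v * (star u * u) := by
    rw [mul_assoc (star v), a1]
    nth_rw 1 [a2']
    rw [mul_assoc, hu]
  have c2 : u * star u = u * star u * (v * star v) := by
    rw [← mul_assoc, a2]
    nth_rw 1 [a1']
    rw [← mul_assoc, ← mul_assoc, hu]
  constructor
  · rw [c1, ← mul_assoc, b1, a1]
  · rw [c2, mul_assoc, b2, a2]

/-- Chains of partial isometries with orthogonal initial and final spaces have upper bounds, their
strong limits; Zorn's lemma then gives a maximal one. -/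
theorem exists_upperBound_partialIsometry {B : VonNeumannAlgebra E}
    (c : Set (nilpotentPartialIsometries B))
    (hc : IsChain (fun v w : nilpotentPartialIsometries B =>
      PartialIsometryLE (v : E →L[ℂ] E) w) c) :
    ∃ ub : nilpotentPartialIsometries B, ∀ v ∈ c, PartialIsometryLE (v : E →L[ℂ] E) ub := by
  rcases c.eq_empty_or_nonempty with rfl | hne
  · exact ⟨⟨0, zero_mem B, by simp, by simp⟩, by simp⟩
  have : Nonempty c := hne.to_subtype
  have hrefl : ∀ v : c, PartialIsometryLE (v : E →L[ℂ] E) v := fun v =>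
    ⟨by rw [← mul_assoc]; exact v.1.2.2.1, v.1.2.2.1⟩
  let l : Filter c := ⨅ v : c, 𝓟 {w | PartialIsometryLE (v : E →L[ℂ] E) w}
  have hl : ∀ v : c, ∀ᶠ w : c in l, PartialIsometryLE (v : E →L[ℂ] E) w := fun v =>
    mem_iInf_of_mem v (mem_principal_self _)
  have : l.NeBot := by
    refine iInf_neBot_of_directed' (fun v w => ?_) fun v => principal_neBot_iff.2 ⟨v, hrefl v⟩
    have htot : PartialIsometryLE (v : E →L[ℂ] E) w ∨ PartialIsometryLE (w : E →L[ℂ] E) v := by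
      rcases eq_or_ne v w with rfl | hvw
      · exact Or.inl (hrefl v)
      · exact hc v.2 w.2 fun h => hvw (Subtype.ext h)
    rcases htot with h | h
    · exact ⟨w, principal_mono.2 fun x hx => partialIsometryLE_trans v.1.2.2.1 h hx, le_rfl⟩
    · exact ⟨v, le_rfl, principal_mono.2 fun x hx => partialIsometryLE_trans w.1.2.2.1 h hx⟩
  let T : c → E →L[ℂ] E := fun v => v
  have hT : ∀ v, T v * star (T v) * T v = T v := fun v => v.1.2.2.1
  have hT' : ∀ v, star (T v) * star (star (T v)) * star (T v) = star (T v) := fun v => by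
    rw [← star_mul, ← star_mul, ← mul_assoc, hT]
  obtain ⟨V, hV⟩ := exists_strong_limit_of_partialIsometry (l := l) hT
    fun v => (hl v).mono fun w hw => hw.2
  obtain ⟨W, hW⟩ := exists_strong_limit_of_partialIsometry (l := l) (T := fun v => star (T v)) hT'
    fun v => (hl v).mono fun w hw => by
      rw [← star_mul, ← star_mul]
      exact congrArg star (by simpa using hw.1)
  have hn : ∀ v, ‖T v‖ ≤ 1 := fun v => norm_le_one_of_partialIsometry (hT v)
  have hVW : star V = W := by
    refine (ContinuousLinearMap.eq_adjoint_iff W V).2 (fun ξ η => ?_) |>.symm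
    refine tendsto_nhds_unique ((hW ξ).inner tendsto_const_nhds) ?_
    refine Tendsto.congr (fun v => ?_) (tendsto_const_nhds.inner (hV η))
    exact (ContinuousLinearMap.adjoint_inner_left (T v) _ _).symm
  subst hVW
  have huniq : ∀ {S : c → E →L[ℂ] E} {S₁ S₂ : E →L[ℂ] E}, (∀ᶠ v in l, S v = S₁) →
      (∀ ξ, Tendsto (fun v => S v ξ) l (𝓝 (S₂ ξ))) → S₂ = S₁ := by
    intro S S₁ S₂ h1 h2
    ext ξ
    refine tendsto_nhds_unique (h2 ξ) (tendsto_const_nhds.congr' ?_)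
    filter_upwards [h1] with v hv
    rw [hv]
  refine ⟨⟨V, mem_of_commute fun t ht => ?_, ?_, ?_⟩, fun v hv => ⟨?_, ?_⟩⟩
  · ext ξ
    refine tendsto_nhds_unique (tendsto_mul_apply (T := fun _ => t) (fun _ => le_rfl)
      (fun _ => tendsto_const_nhds) hV ξ) ?_
    refine Tendsto.congr (fun v => ?_)
      (tendsto_mul_apply (S := fun _ => t) hn hV (fun _ => tendsto_const_nhds) ξ)
    exact (congrArg (fun S : E →L[ℂ] E => S ξ) (commute_of_mem v.1.2.1 ht).eq).symm
  · ext ξ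
    refine tendsto_nhds_unique (tendsto_mul_apply (T := fun v => T v * star (T v)) (C := 1)
      (fun v => ?_) (tendsto_mul_apply hn hV hW) hV ξ) ((hV ξ).congr fun v => ?_)
    · refine (norm_mul_le _ _).trans ?_
      rw [norm_star]
      exact mul_le_one₀ (hn v) (norm_nonneg _) (hn v)
    · exact (congrArg (fun S : E →L[ℂ] E => S ξ) (hT v)).symm
  · exact huniq (S := fun v => T v * T v) (Eventually.of_forall fun v => v.1.2.2.2)
      (tendsto_mul_apply hn hV hV)
  · refine huniq (S := fun w => T w * (star (T ⟨v, hv⟩) * T ⟨v, hv⟩)) ?_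
      (tendsto_mul_apply hn hV fun _ => tendsto_const_nhds)
    exact (hl ⟨v, hv⟩).mono fun w hw => hw.1
  · refine huniq (S := fun w => (T ⟨v, hv⟩ * star (T ⟨v, hv⟩)) * T w) ?_
      (tendsto_mul_apply (fun _ => le_rfl) (fun _ => tendsto_const_nhds) hV)
    exact (hl ⟨v, hv⟩).mono fun w hw => hw.2

/-- Halving: a von Neumann algebra without abelian projections contains a unital copy of the `2 × 2`
matrices, generated by a maximal partial isometry with orthogonal initial and final spaces. -/
theorem exists_halving {B : VonNeumannAlgebra E} (hB : NoAbelianProjection B) :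
    ∃ v ∈ B, v * v = 0 ∧ star v * v + v * star v = 1 := by
  obtain ⟨⟨v, hvB, hv, hvv⟩, hmax⟩ := exists_maximal_of_chains_bounded
    (r := fun v w : nilpotentPartialIsometries B => PartialIsometryLE (v : E →L[ℂ] E) w)
    exists_upperBound_partialIsometry fun {u v w} h1 h2 =>
      partialIsometryLE_trans u.2.2.1 h1 h2
  refine ⟨v, hvB, hvv, ?_⟩
  set q := 1 - (star v * v + v * star v) with hq
  have hqv : q * v = 0 := by
    rw [hq, sub_mul, add_mul, hv, mul_assoc, hvv]; simp
  have hvq : v * q = 0 := by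
    rw [hq, mul_sub, mul_add, ← mul_assoc, ← mul_assoc, hv, hvv]; simp
  have hqsa : IsSelfAdjoint q := by
    rw [hq, IsSelfAdjoint]; simp
  have hsvq : star v * q = 0 := by
    have := congrArg star hqv
    rwa [star_mul, hqsa.star_eq, star_zero] at this
  have hqsv : q * star v = 0 := by
    have := congrArg star hvq
    rwa [star_mul, hqsa.star_eq, star_zero] at this
  have hqq : IsStarProjection q := by
    refine ⟨?_, hqsa⟩
    rw [IsIdempotentElem]
    nth_rw 2 [hq]
    rw [mul_sub, mul_add, ← mul_assoc, ← mul_assoc, hqv, hqsv]; simp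
  have hqB : q ∈ B := sub_mem (one_mem B)
    (add_mem (mul_mem (star_mem hvB) hvB) (mul_mem hvB (star_mem hvB)))
  suffices hq0 : q = 0 by
    rw [hq, sub_eq_zero] at hq0
    exact hq0.symm
  refine hB q ⟨hqB, hqq, fun x hx y hy => ?_⟩
  by_contra hne
  obtain ⟨z, hzB, hz0, hzz, hqz, hzq⟩ := exists_mul_self_eq_zero hqB hqq hx hy hne
  obtain ⟨w, hwB, hw, hwz, hw1, hw2⟩ := exists_polar hzB
  have hww : w * w = 0 := hw1 w (hw2 z hzz)
  have hqw : q * w = w := by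
    have := hw2 (1 - q) (by rw [sub_mul, one_mul, hqz, sub_self])
    rw [sub_mul, one_mul, sub_eq_zero] at this
    exact this.symm
  have hwq : w * q = w := by
    have := hw1 (1 - q) (by rw [mul_sub, mul_one, hzq, sub_self])
    rw [mul_sub, mul_one, sub_eq_zero] at this
    exact this.symm
  have hqsw : q * star w = star w := by
    have := congrArg star hwq
    rwa [star_mul, hqsa.star_eq] at this
  have e1 : v * w = 0 := by rw [← hqw, ← mul_assoc, hvq, zero_mul]
  have e2 : w * v = 0 := by rw [← hwq, mul_assoc, hqv, mul_zero]
  have e3 : v * star w = 0 := by rw [← hqsw, ← mul_assoc, hvq, zero_mul]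
  have e4 : w * star v = 0 := by rw [← hwq, mul_assoc, hqsv, mul_zero]
  have e5 : star v * w = 0 := by rw [← hqw, ← mul_assoc, hsvq, zero_mul]
  have e6 : star w * v = 0 := by
    have := congrArg star e5
    rwa [star_mul, star_star, star_zero] at this
  have hle := hmax ⟨v + w, add_mem hvB hwB, by
      rw [star_add, mul_add (v + w), add_mul v w, add_mul v w, e3, e4, zero_add, add_zero, mul_add,
        add_mul, add_mul, hv, hw, mul_assoc v, mul_assoc w, e5, e6, mul_zero, mul_zero, add_zero,
        zero_add], by
      rw [mul_add, add_mul, add_mul, hvv, hww, e1, e2]; simp⟩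
    ⟨by
      change (v + w) * (star v * v) = v
      rw [add_mul, ← mul_assoc, ← mul_assoc, hv, e4, zero_mul, add_zero], by
      change v * star v * (v + w) = v
      rw [mul_add, hv, mul_assoc, e5, mul_zero, add_zero]⟩
  have h1 : v * (star (v + w) * (v + w)) = v + w := hle.1
  rw [star_add, ← mul_assoc, mul_add v, e3, add_zero, mul_add, hv, mul_assoc, e5, mul_zero] at h1
  have h2 : w = 0 := by simpa using h1.symm
  rw [h2, zero_mul] at hwz
  exact hz0 hwz.symm

end Halving

/-! ### Relative commutants of finite-dimensional algebras -/

section RelativeCommutant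

variable {E : Type*} [NormedAddCommGroup E] [InnerProductSpace ℂ E] [CompleteSpace E]

/-- The relative commutant `A' ∩ B` of a `*`-algebra `A` in a von Neumann algebra `B`. -/
def relCommutant (A : StarSubalgebra ℂ (E →L[ℂ] E)) (B : VonNeumannAlgebra E) :
    VonNeumannAlgebra E :=
  (generated ((A : Set (E →L[ℂ] E)) ∪ (B.commutant : Set (E →L[ℂ] E)))).commutant

theorem mem_relCommutant {A : StarSubalgebra ℂ (E →L[ℂ] E)} {B : VonNeumannAlgebra E}
    {x : E →L[ℂ] E} : x ∈ relCommutant A B ↔ x ∈ B ∧ ∀ a ∈ A, Commute a x := by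
  rw [relCommutant, ← SetLike.mem_coe, VonNeumannAlgebra.coe_commutant, coe_generated,
    Set.centralizer_centralizer_centralizer]
  constructor
  · intro h
    refine ⟨mem_of_commute fun t ht => ?_, fun a ha => ?_⟩
    · exact h t (Or.inl (Or.inr ht))
    · exact h a (Or.inl (Or.inl ha))
  · rintro ⟨hB, hA⟩ t ((ht | ht) | (ht | ht))
    · exact hA t ht
    · exact commute_of_mem hB ht
    · exact hA t (by simpa using star_mem ht)
    · exact commute_of_mem hB (by simpa using (star_mem ht : star (star t) ∈ B.commutant))

/-- The spectrum consists of roots of an annihilating polynomial. -/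
theorem finite_spectrum_of_mem {A : StarSubalgebra ℂ (E →L[ℂ] E)} [FiniteDimensional ℂ A]
    {h : E →L[ℂ] E} (hA : h ∈ A) : (spectrum ℝ h).Finite := by
  obtain ⟨q, hq, hq0⟩ := (Algebra.IsIntegral.isIntegral (R := ℂ) (⟨h, hA⟩ : A))
  have hq1 : Polynomial.aeval h q = 0 := by
    have h1 := congrArg A.subtype hq0
    rw [← Polynomial.aeval_def, ← Polynomial.aeval_algHom_apply, map_zero] at h1
    exact h1
  have hfin : (spectrum ℂ h).Finite := by
    refine (q.roots.toFinset.finite_toSet).subset fun z hz => ?_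
    have h1 := spectrum.subset_polynomial_aeval h q ⟨z, hz, rfl⟩
    rw [hq1] at h1
    have : Nontrivial (E →L[ℂ] E) := by
      by_contra hnt
      rw [not_nontrivial_iff_subsingleton] at hnt
      exact hz (isUnit_of_subsingleton _)
    rw [spectrum.zero_eq] at h1
    simpa [hq.ne_zero] using h1
  rw [← spectrum.preimage_algebraMap ℂ (R := ℝ)]
  exact hfin.preimage (FaithfulSMul.algebraMap_injective ℝ ℂ).injOn

/-- A finite-dimensional `*`-algebra contains, for every `e ≠ 0`, a minimal projection `a` with
`a e ≠ 0`. -/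
theorem exists_minimal_projection {A : StarSubalgebra ℂ (E →L[ℂ] E)} [FiniteDimensional ℂ A]
    {e : E →L[ℂ] E} (he : e ≠ 0) :
    ∃ a ∈ A, IsStarProjection a ∧ a * e ≠ 0 ∧ ∀ x ∈ A, ∃ c : ℂ, a * x * a = c • a := by
  let W : (E →L[ℂ] E) → Submodule ℂ (E →L[ℂ] E) := fun p =>
    A.toSubalgebra.toSubmodule.map (LinearMap.mulLeft ℂ p)
  obtain ⟨a, ⟨haA, hap, hae⟩, hmin⟩ := (measure fun p => Module.finrank ℂ (W p)).wf.has_min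
    {p | p ∈ A ∧ IsStarProjection p ∧ p * e ≠ 0}
    ⟨1, one_mem A, IsStarProjection.one _, by simpa using he⟩
  refine ⟨a, haA, hap, hae, ?_⟩
  -- a projection of `A` below `a` not killing `e` is equal to `a`
  have hmin' : ∀ p ∈ A, IsStarProjection p → p * e ≠ 0 → a * p = p → p = a := by
    intro p hpA hp hpe hap'
    by_contra hne
    refine hmin p ⟨hpA, hp, hpe⟩ ?_
    have : FiniteDimensional ℂ A.toSubalgebra.toSubmodule := ‹FiniteDimensional ℂ A›
    have : FiniteDimensional ℂ (W a) := by dsimp only [W]; infer_instance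
    refine Submodule.finrank_lt_finrank_of_lt (lt_of_le_of_ne ?_ ?_)
    · rintro _ ⟨x, hx, rfl⟩
      refine ⟨p * x, A.mul_mem hpA hx, ?_⟩
      simp [← mul_assoc, hap']
    · intro heq
      have h1 : a ∈ W a := ⟨1, one_mem A, by simp⟩
      rw [← heq] at h1
      obtain ⟨x, -, hx⟩ := h1
      have h2 : p * a = a := by
        rw [← hx]
        simp [← mul_assoc, hp.isIdempotentElem.eq]
      have h3 := congrArg star hap'
      rw [star_mul, hp.isSelfAdjoint.star_eq, hap.isSelfAdjoint.star_eq, h2] at h3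
      exact hne h3.symm
  have hclosed : IsClosed (A : Set (E →L[ℂ] E)) := by
    have : FiniteDimensional ℂ A.toSubalgebra.toSubmodule := ‹FiniteDimensional ℂ A›
    exact Submodule.closed_of_finiteDimensional A.toSubalgebra.toSubmodule
  have hsa : ∀ h ∈ A, IsSelfAdjoint h → a * h = h → ∃ c : ℂ, h = c • a := by
    intro h hA hh hah
    rcases eq_or_ne h 0 with rfl | h0
    · exact ⟨0, by simp⟩
    obtain ⟨t, ht, ht0⟩ : ∃ t ∈ spectrum ℝ h, t ≠ 0 := by
      by_contra! hcon
      exact h0 (CFC.eq_zero_of_spectrum_subset_zero (R := ℝ) _ (fun t ht => hcon t ht) hh)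
    have hfin := finite_spectrum_of_mem hA
    let χ : ℝ → ℝ := fun s => if s = t then 1 else 0
    have hχ : ContinuousOn χ (spectrum ℝ h) := hfin.continuousOn _
    set p := cfc χ h with hp
    have hpA : p ∈ A := cfc_mem (𝕜 := ℝ) (𝕜' := ℂ) (hs := hclosed) χ hA
    have hpsa : IsSelfAdjoint p := cfc_predicate _ h
    have hpp : IsStarProjection p := by
      refine ⟨?_, hpsa⟩
      rw [IsIdempotentElem, hp, ← cfc_mul χ χ h hχ hχ]
      congr 1
      ext s
      simp [χ]
    have hph : h * p = t • p := by
      nth_rw 1 [← cfc_id ℝ h]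
      rw [hp, ← cfc_mul id χ h continuousOn_id hχ, ← cfc_smul t χ h hχ]
      congr 1
      ext s
      by_cases hs : s = t <;> simp [χ, hs]
    have hphc : h * p = p * h := (((Commute.refl h).cfc_real χ).symm).eq
    have hap' : a * p = p := by
      have h1 : p = t⁻¹ • (h * p) := by rw [hph, smul_smul, inv_mul_cancel₀ ht0, one_smul]
      rw [h1, mul_smul_comm, ← mul_assoc, hah]
    have hp0 : p ≠ 0 := by
      intro h0'
      have h2 : χ t ∈ spectrum ℝ p := by
        rw [hp, cfc_map_spectrum (R := ℝ) χ h hh hχ]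
        exact ⟨t, ht, rfl⟩
      have : Nontrivial (E →L[ℂ] E) := ⟨_, _, h0⟩
      rw [h0', spectrum.zero_eq] at h2
      simp [χ] at h2
    have hpa : p * a = p := by
      have := congrArg star hap'
      rwa [star_mul, hpsa.star_eq, hap.isSelfAdjoint.star_eq] at this
    by_cases hpe : p * e = 0
    · exfalso
      have h1 : a - p = a := by
        refine hmin' _ (sub_mem haA hpA) ⟨?_, hap.isSelfAdjoint.sub hpsa⟩ ?_ ?_
        · rw [IsIdempotentElem, sub_mul, mul_sub, mul_sub, hap.isIdempotentElem.eq,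
            hpp.isIdempotentElem.eq, hap', hpa]
          simp
        · rwa [sub_mul, hpe, sub_zero]
        · rw [mul_sub, hap.isIdempotentElem.eq, hap']
      exact hp0 (by simpa using h1)
    · have h1 := hmin' p hpA hpp hpe hap'
      refine ⟨(t : ℂ), ?_⟩
      have hha : h * a = h := by
        have := congrArg star hah
        rwa [star_mul, hh.star_eq, hap.isSelfAdjoint.star_eq] at this
      rw [Complex.coe_smul, ← hha, ← h1, hph]
  intro x hx
  have hsa' : ∀ y ∈ A, IsSelfAdjoint y → ∃ c : ℂ, a * y * a = c • a := fun y hy hys => by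
    refine hsa _ (mul_mem (mul_mem haA hy) haA) ?_ ?_
    · have := hys.conjugate a
      rwa [hap.isSelfAdjoint.star_eq] at this
    · rw [← mul_assoc, ← mul_assoc, hap.isIdempotentElem.eq]
  obtain ⟨c₁, h1⟩ := hsa' (realPart x) (by
    rw [realPart_apply_coe, ← Complex.coe_smul]
    exact A.smul_mem (add_mem hx (star_mem hx)) _) (realPart x).2
  obtain ⟨c₂, h2⟩ := hsa' (imaginaryPart x) (by
    rw [imaginaryPart_apply_coe, ← Complex.coe_smul]
    exact A.smul_mem (A.smul_mem (sub_mem hx (star_mem hx)) _) _) (imaginaryPart x).2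
  refine ⟨c₁ + Complex.I * c₂, ?_⟩
  rw [← realPart_add_I_smul_imaginaryPart x]
  simp only [mul_add, add_mul, mul_smul_comm, smul_mul_assoc, h1, h2, add_smul, mul_smul]

/-- If `a` is a minimal projection of the finite-dimensional `*`-algebra `A`, then every element of
the corner `aBa` is the compression of an element of `A' ∩ B`: with an orthonormal basis `vᵢ` of
`Aa`, for the inner product given by `v* w = ⟪v, w⟫ a`, this is `∑ᵢ vᵢ y vᵢ*`. -/
theorem exists_mem_relCommutant_mul_eq {A : StarSubalgebra ℂ (E →L[ℂ] E)} [FiniteDimensional ℂ A]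
    {B : VonNeumannAlgebra E} (hAB : ∀ x ∈ A, x ∈ B) {a : E →L[ℂ] E} (haA : a ∈ A)
    (ha : IsStarProjection a) (hmin : ∀ x ∈ A, ∃ c : ℂ, a * x * a = c • a)
    {y : E →L[ℂ] E} (hyB : y ∈ B) :
    ∃ x ∈ relCommutant A B, x * a = a * y * a := by
  rcases eq_or_ne a 0 with rfl | ha0
  · exact ⟨0, zero_mem _, by simp⟩
  obtain ⟨ξ, hξa, hξ⟩ : ∃ ξ, a ξ = ξ ∧ ‖ξ‖ = 1 := by
    obtain ⟨η, hη⟩ : ∃ η, a η ≠ 0 := by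
      by_contra! h
      exact ha0 (by ext η; exact h η)
    have haa : a (a η) = a η := congrArg (fun T : E →L[ℂ] E => T η) ha.isIdempotentElem.eq
    refine ⟨((‖a η‖⁻¹ : ℝ) : ℂ) • a η, by rw [map_smul, haa], ?_⟩
    rw [norm_smul]
    simp [hη]
  have hinner : ∀ S T : E →L[ℂ] E, inner ℂ (S ξ) (T ξ) = inner ℂ ξ ((star S * T) ξ) :=
    fun S T => (ContinuousLinearMap.adjoint_inner_right S ξ (T ξ)).symm
  -- evaluation at `ξ` is injective on `Aa`
  have hinj : ∀ x ∈ A, x * a = x → x ξ = 0 → x = 0 := by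
    intro x hx hxa hxξ
    obtain ⟨c, hc⟩ := hmin (star x * x) (mul_mem (star_mem hx) hx)
    have h1 : a * (star x * x) * a = star x * x := by
      have := congrArg star hxa
      rw [star_mul, ha.isSelfAdjoint.star_eq] at this
      rw [← mul_assoc, this, mul_assoc, hxa]
    have h2 := hinner x x
    rw [← h1, hc, hxξ, inner_zero_left, smul_apply, hξa, inner_smul_right,
      inner_self_eq_norm_sq_to_K, hξ] at h2
    rw [h1, show c = 0 by simpa using h2.symm, zero_smul] at hc
    exact CStarRing.star_mul_self_eq_zero_iff _ |>.1 hc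
  let ev : (E →L[ℂ] E) →ₗ[ℂ] E := (ContinuousLinearMap.apply ℂ E ξ : (E →L[ℂ] E) →ₗ[ℂ] E)
  let V : Submodule ℂ E := A.toSubalgebra.toSubmodule.map ev
  have : FiniteDimensional ℂ A.toSubalgebra.toSubmodule := ‹FiniteDimensional ℂ A›
  have : FiniteDimensional ℂ V := by dsimp only [V]; infer_instance
  let b := stdOrthonormalBasis ℂ V
  have hv : ∀ i, ∃ v ∈ A, v * a = v ∧ v ξ = b i := by
    intro i
    obtain ⟨x, hx, hxi⟩ := (b i).2
    refine ⟨x * a, mul_mem hx haA, by rw [mul_assoc, ha.isIdempotentElem.eq], ?_⟩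
    rw [mul_apply_eq_comp, hξa]
    exact hxi
  choose v hvA hva hvξ using hv
  have hexp : ∀ x ∈ A, x * a = x → x = ∑ i, inner ℂ (b i : E) (x ξ) • v i := by
    intro x hx hxa
    rw [← sub_eq_zero]
    refine hinj _ (sub_mem hx (sum_mem fun i _ => A.smul_mem (hvA i) _)) ?_ ?_
    · rw [sub_mul, hxa, Finset.sum_mul]
      simp only [smul_mul_assoc, hva]
    · have h1 : (⟨x ξ, x, hx, rfl⟩ : V) = ∑ i, inner ℂ (b i : E) (x ξ) • b i :=
        (b.sum_repr' ⟨x ξ, x, hx, rfl⟩).symm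
      have h2 := congrArg (Subtype.val) h1
      simp only [AddSubmonoidClass.coe_finsetSum, Submodule.coe_smul] at h2
      simp only [sub_apply, sum_apply, smul_apply, hvξ]
      rw [← h2, sub_self]
  set w := a * y * a with hw
  have haw : a * w = w := by rw [hw, ← mul_assoc, ← mul_assoc, ha.isIdempotentElem.eq]
  refine ⟨∑ i, v i * w * star (v i), mem_relCommutant.2 ⟨?_, fun c hc => ?_⟩, ?_⟩
  · exact sum_mem fun i _ => mul_mem (mul_mem (hAB _ (hvA i))
      (mul_mem (mul_mem (hAB a haA) hyB) (hAB a haA))) (star_mem (hAB _ (hvA i)))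
  · have h1 : ∀ i, c * v i = ∑ j, inner ℂ (b j : E) (c (b i)) • v j := fun i => by
      have := hexp (c * v i) (mul_mem hc (hvA i)) (by rw [mul_assoc, hva])
      rwa [mul_apply_eq_comp, hvξ] at this
    have h2 : ∀ j, star (v j) * c = ∑ i, inner ℂ (b j : E) (c (b i)) • star (v i) := fun j => by
      have := hexp (star c * v j) (mul_mem (star_mem hc) (hvA j)) (by rw [mul_assoc, hva])
      rw [mul_apply_eq_comp, hvξ] at this
      have h3 := congrArg star this
      rw [star_mul, star_star, star_sum] at h3
      rw [h3]
      refine Finset.sum_congr rfl fun i _ => ?_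
      have h4 : inner ℂ (b i : E) ((star c) (b j)) = inner ℂ (c (b i)) (b j : E) :=
        ContinuousLinearMap.adjoint_inner_right c _ _
      rw [star_smul, h4]
      congr 1
      exact inner_conj_symm _ _
    rw [Commute, SemiconjBy, Finset.mul_sum, Finset.sum_mul]
    simp only [← mul_assoc, h1]
    simp only [mul_assoc, h2]
    simp only [Finset.sum_mul, Finset.mul_sum, smul_mul_assoc, mul_smul_comm]
    rw [Finset.sum_comm]
  · have h1 : ∀ i, star (v i) * a = inner ℂ (b i : E) (a ξ) • a := fun i => by
      obtain ⟨c, hc⟩ := hmin (v i) (hvA i)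
      rw [mul_assoc, hva] at hc
      have h2 : inner ℂ ξ (v i ξ) = c := by
        have h3 : inner ℂ ξ ((a * v i) ξ) = inner ℂ ξ (v i ξ) := by
          have : inner ℂ (a ξ) (v i ξ) = inner ℂ ξ (a (v i ξ)) := ha.isSelfAdjoint.isSymmetric _ _
          rw [mul_apply_eq_comp, ← this, hξa]
        rw [← h3, hc, smul_apply, hξa, inner_smul_right, inner_self_eq_norm_sq_to_K, hξ]
        simp
      have h4 := congrArg star hc
      rw [star_mul, ha.isSelfAdjoint.star_eq, star_smul, ha.isSelfAdjoint.star_eq] at h4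
      rw [h4, hξa, ← h2, hvξ]
      congr 1
      exact inner_conj_symm _ _
    rw [Finset.sum_mul]
    simp only [mul_assoc, h1]
    have h5 : w * a = w := by rw [hw, mul_assoc, ha.isIdempotentElem.eq]
    simp only [mul_smul_comm, h5]
    simp only [← smul_mul_assoc]
    rw [← Finset.sum_mul, ← hexp a haA ha.isIdempotentElem.eq, haw]

/-- Passing to the relative commutant of a finite-dimensional algebra creates no abelian
projections: if `e ∈ A' ∩ B` is abelian and `a` is a minimal projection of `A`, then the corner of
`B` at `ae` is a compression of `e(A' ∩ B)e`, so it is commutative. -/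
theorem NoAbelianProjection.relCommutant {A : StarSubalgebra ℂ (E →L[ℂ] E)}
    [FiniteDimensional ℂ A] {B : VonNeumannAlgebra E} (hAB : ∀ x ∈ A, x ∈ B)
    (hB : NoAbelianProjection B) : NoAbelianProjection (relCommutant A B) := by
  rintro e ⟨heC, he, hab⟩
  by_contra he0
  obtain ⟨heB, hec⟩ := mem_relCommutant.1 heC
  obtain ⟨a, haA, ha, hae, hmin⟩ := exists_minimal_projection (A := A) he0
  have hcomm : a * e = e * a := hec a haA
  refine hae (hB (a * e) ⟨mul_mem (hAB a haA) heB, ha.mul he hcomm, ?_⟩)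
  -- the compression of `y ∈ B` to `ae` is the product of `a` and an element of `e(A' ∩ B)e`
  have key : ∀ y ∈ B, ∃ x ∈ VNTensor.relCommutant A B, (a * e) * y * (a * e) = (e * x * e) * a := by
    intro y hy
    obtain ⟨x, hx, hxa⟩ := exists_mem_relCommutant_mul_eq hAB haA ha hmin hy
    refine ⟨x, hx, ?_⟩
    calc (a * e) * y * (a * e) = e * (a * y * a) * e := by
          nth_rw 1 [hcomm]
          simp only [mul_assoc]
      _ = e * x * e * a := by rw [← hxa, mul_assoc, mul_assoc, mul_assoc, mul_assoc, hcomm]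
  intro x hx y hy
  obtain ⟨x', hx', hx''⟩ := key x hx
  obtain ⟨y', hy', hy''⟩ := key y hy
  have hca : ∀ z ∈ VNTensor.relCommutant A B, Commute a (e * z * e) := fun z hz =>
    ((hec a haA).mul_right ((mem_relCommutant.1 hz).2 a haA)).mul_right (hec a haA)
  have h := hab x' hx' y' hy'
  rw [hx'', hy'']
  have h1 : Commute (e * x' * e * a) (e * y' * e) := Commute.mul_left h (hca y' hy')
  exact (h1.mul_right ((hca x' hx').symm.mul_left (Commute.refl a))).eq

end RelativeCommutant

/-! ### Matrix units -/

section MatrixUnits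

variable {E : Type*} [NormedAddCommGroup E] [InnerProductSpace ℂ E] [CompleteSpace E]

/-- A system of matrix units with sum of the diagonal projections equal to `1`. -/
structure IsMatrixUnits {ι : Type*} [Fintype ι] [DecidableEq ι] (f : ι → ι → E →L[ℂ] E) :
    Prop where
  mul : ∀ i j k l, f i j * f k l = if j = k then f i l else 0
  star : ∀ i j, star (f i j) = f j i
  sum : ∑ i, f i i = 1

/-- The partial isometry of a halving is the off-diagonal matrix unit of a copy of the `2 × 2`
matrices. -/
theorem isMatrixUnits_of_halving {v : E →L[ℂ] E} (hvv : v * v = 0)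
    (hv : star v * v + v * star v = 1) :
    IsMatrixUnits (fun b c : Bool => if b then (if c then v * star v else v)
      else (if c then star v else star v * v)) := by
  have h1 : v * star v * v = v := by
    have := congrArg (v * ·) hv
    simpa [mul_add, ← mul_assoc, hvv] using this
  have h2 : star v * star v = 0 := by rw [← star_mul, hvv, star_zero]
  have h3 : star v * v * star v = star v := by
    have := congrArg star h1
    simpa [mul_assoc] using this
  have h4 : ∀ x, v * (v * x) = 0 := fun x => by rw [← mul_assoc, hvv, zero_mul]
  have h5 : ∀ x, star v * (star v * x) = 0 := fun x => by rw [← mul_assoc, h2, zero_mul]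
  rw [mul_assoc] at h1 h3
  refine ⟨fun i j k l => ?_, fun i j => ?_, ?_⟩
  · cases i <;> cases j <;> cases k <;> cases l <;>
      simp [mul_assoc, hvv, h2, h1, h3, h4, h5]
  · cases i <;> cases j <;> simp
  · simpa [add_comm] using hv

theorem finiteDimensional_adjoin_of_halving {v : E →L[ℂ] E} (hvv : v * v = 0)
    (hv : star v * v + v * star v = 1) :
    FiniteDimensional ℂ (StarAlgebra.adjoin ℂ {v} : StarSubalgebra ℂ (E →L[ℂ] E)) := by
  have h1 : v * star v * v = v := by
    have := congrArg (v * ·) hv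
    simpa [mul_add, ← mul_assoc, hvv] using this
  have h2 : star v * star v = 0 := by rw [← star_mul, hvv, star_zero]
  have h3 : star v * v * star v = star v := by
    have := congrArg star h1
    simpa [mul_assoc] using this
  -- `v` and `v*` generate a finite multiplicative monoid
  let m : Submonoid (E →L[ℂ] E) :=
    { carrier := {1, 0, v, star v, star v * v, v * star v}
      one_mem' := by simp
      mul_mem' := by
        have h8 : ∀ x, x * v * v = 0 := fun x => by rw [mul_assoc, hvv, mul_zero]
        have h9 : ∀ x, x * star v * star v = 0 := fun x => by rw [mul_assoc, h2, mul_zero]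
        rintro x y (hx | hx | hx | hx | hx | hx) (hy | hy | hy | hy | hy | hy) <;>
          rw [hx, hy] <;>
          simp only [one_mul, mul_one, zero_mul, mul_zero, ← mul_assoc, hvv, h1, h2, h3, h8, h9,
            Set.mem_insert_iff, Set.mem_singleton_iff, true_or, or_true] }
  have hfin : (m : Set (E →L[ℂ] E)).Finite := by
    change ({1, 0, v, star v, star v * v, v * star v} : Set (E →L[ℂ] E)).Finite
    simp
  have hle : Submonoid.closure ({v} ∪ star {v}) ≤ m := by
    rw [Submonoid.closure_le]
    rintro x (hx | hx)
    · exact Or.inr (Or.inr (Or.inl hx))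
    · rw [Set.star_singleton] at hx
      exact Or.inr (Or.inr (Or.inr (Or.inl hx)))
  have hspan : FiniteDimensional ℂ
      (Subalgebra.toSubmodule
        (StarAlgebra.adjoin ℂ {v} : StarSubalgebra ℂ (E →L[ℂ] E)).toSubalgebra) := by
    rw [StarAlgebra.adjoin_toSubalgebra, Algebra.adjoin_eq_span]
    exact FiniteDimensional.span_of_finite ℂ (hfin.subset hle)
  exact hspan

theorem IsMatrixUnits.prod {ι κ : Type*} [Fintype ι] [DecidableEq ι] [Fintype κ] [DecidableEq κ]
    {f : ι → ι → E →L[ℂ] E} {g : κ → κ → E →L[ℂ] E} (hf : IsMatrixUnits f) (hg : IsMatrixUnits g)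
    (h : ∀ i j k l, Commute (g k l) (f i j)) :
    IsMatrixUnits fun p q : ι × κ => f p.1 q.1 * g p.2 q.2 := by
  refine ⟨fun p q r s => ?_, fun p q => ?_, ?_⟩
  · rw [mul_assoc, ← mul_assoc (g _ _), (h _ _ _ _).eq, mul_assoc, ← mul_assoc, hf.mul, hg.mul]
    by_cases h1 : q.1 = r.1 <;> by_cases h2 : q.2 = r.2 <;> simp [h1, h2, Prod.ext_iff]
  · rw [star_mul, hf.star, hg.star, (h _ _ _ _).eq]
  · rw [Fintype.sum_prod_type]
    simp only [← Finset.mul_sum, hg.sum, mul_one, hf.sum]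

/-- A von Neumann algebra without abelian projections contains matrix units of size `2ᵏ`, by halving
successive relative commutants. -/
theorem exists_matrixUnits (k : ℕ) {B : VonNeumannAlgebra E} (hB : NoAbelianProjection B) :
    ∃ (ι : Type) (_ : Fintype ι) (_ : DecidableEq ι) (f : ι → ι → E →L[ℂ] E),
      2 ^ k ≤ Fintype.card ι ∧ IsMatrixUnits f ∧ ∀ i j, f i j ∈ B := by
  induction k generalizing B with
  | zero =>
    refine ⟨Unit, inferInstance, inferInstance, fun _ _ => 1, by simp, ⟨by simp, by simp, by simp⟩,
      fun _ _ => one_mem B⟩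
  | succ k ih =>
    obtain ⟨v, hvB, hvv, hv⟩ := exists_halving hB
    have := finiteDimensional_adjoin_of_halving hvv hv
    have hvA : v ∈ StarAlgebra.adjoin ℂ {v} := StarAlgebra.self_mem_adjoin_singleton ℂ v
    have hle : StarAlgebra.adjoin ℂ {v} ≤ B.toStarSubalgebra :=
      StarAlgebra.adjoin_le (Set.singleton_subset_iff.2 hvB)
    obtain ⟨ι, _, _, f, hcard, hf, hfB⟩ := ih (hB.relCommutant hle)
    have hg := isMatrixUnits_of_halving hvv hv
    have hgA : ∀ b c : Bool, (if b then (if c then v * star v else v)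
        else (if c then star v else star v * v)) ∈ StarAlgebra.adjoin ℂ {v} := by
      intro b c
      cases b <;> cases c
      · exact mul_mem (star_mem hvA) hvA
      · exact star_mem hvA
      · exact hvA
      · exact mul_mem hvA (star_mem hvA)
    refine ⟨ι × Bool, inferInstance, inferInstance, _, ?_, hf.prod hg fun i j b c =>
      (mem_relCommutant.1 (hfB i j)).2 _ (hgA b c), fun p q => ?_⟩
    · rw [Fintype.card_prod, Fintype.card_bool, pow_succ]
      gcongr
    · exact mul_mem (mem_relCommutant.1 (hfB _ _)).1 (hle (hgA _ _))

end MatrixUnits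

/-! ### Matrices of operators -/

section MatrixOperators

variable {E : Type*} [NormedAddCommGroup E] [InnerProductSpace ℂ E] [CompleteSpace E]
  {n : ℕ}

/-- The matrix of an operator on the Hilbert space direct sum `Eⁿ`. -/
def entry (Z : PiLp 2 (fun _ : Fin n => E) →L[ℂ] PiLp 2 (fun _ : Fin n => E)) :
    Matrix (Fin n) (Fin n) (E →L[ℂ] E) :=
  Matrix.of fun i j => PiLp.proj 2 (fun _ : Fin n => E) i ∘L Z ∘L
    (PiLp.continuousLinearEquiv 2 ℂ (fun _ : Fin n => E)).symm.toContinuousLinearMap ∘L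
      ContinuousLinearMap.single ℂ (fun _ : Fin n => E) j

theorem entry_apply (Z : PiLp 2 (fun _ : Fin n => E) →L[ℂ] PiLp 2 (fun _ : Fin n => E))
    (i j : Fin n) (ξ : E) : entry Z i j ξ = Z (WithLp.toLp 2 (Pi.single j ξ)) i := rfl

theorem matrixOp_entry (Z : PiLp 2 (fun _ : Fin n => E) →L[ℂ] PiLp 2 (fun _ : Fin n => E)) :
    matrixOp (entry Z) = Z := by
  ext ξ i
  rw [matrixOp_apply]
  simp only [entry_apply]
  have h : ξ = ∑ j, WithLp.toLp 2 (Pi.single j (ξ j)) := by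
    ext i
    simp [Finset.sum_apply, Pi.single_apply]
  conv_rhs => rw [h, map_sum]
  simp

theorem entry_matrixOp (X : Matrix (Fin n) (Fin n) (E →L[ℂ] E)) : entry (matrixOp X) = X := by
  ext i j ξ
  rw [entry_apply, matrixOp_apply, Finset.sum_eq_single j] <;> simp +contextual

theorem matrixOp_mul (X Y : Matrix (Fin n) (Fin n) (E →L[ℂ] E)) :
    matrixOp (X * Y) = matrixOp X * matrixOp Y := by
  ext ξ i
  rw [mul_apply_eq_comp]
  simp only [matrixOp_apply, Matrix.mul_apply, sum_apply, mul_apply_eq_comp, map_sum]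
  exact Finset.sum_comm

theorem matrixOp_add (X Y : Matrix (Fin n) (Fin n) (E →L[ℂ] E)) :
    matrixOp (X + Y) = matrixOp X + matrixOp Y := by
  ext ξ i
  simp [matrixOp_apply, Finset.sum_add_distrib]

theorem entry_mul (Y Z : PiLp 2 (fun _ : Fin n => E) →L[ℂ] PiLp 2 (fun _ : Fin n => E)) :
    entry (Y * Z) = entry Y * entry Z := by
  rw [← entry_matrixOp (entry Y * entry Z), matrixOp_mul, matrixOp_entry, matrixOp_entry]

theorem entry_add (Y Z : PiLp 2 (fun _ : Fin n => E) →L[ℂ] PiLp 2 (fun _ : Fin n => E)) :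
    entry (Y + Z) = entry Y + entry Z := by
  rw [← entry_matrixOp (entry Y + entry Z), matrixOp_add, matrixOp_entry, matrixOp_entry]

theorem entry_algebraMap (c : ℂ) (i j : Fin n) :
    entry (algebraMap ℂ (PiLp 2 (fun _ : Fin n => E) →L[ℂ] PiLp 2 (fun _ : Fin n => E)) c) i j =
      if i = j then algebraMap ℂ (E →L[ℂ] E) c else 0 := by
  ext ξ
  rw [entry_apply]
  by_cases h : i = j <;> simp [Algebra.algebraMap_eq_smul_one, h]

theorem entry_star
    (Z : PiLp 2 (fun _ : Fin n => E) →L[ℂ] PiLp 2 (fun _ : Fin n => E)) (i j : Fin n) :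
    entry (star Z) i j = star (entry Z j i) := by
  refine (ContinuousLinearMap.eq_adjoint_iff _ _).2 fun ξ η => ?_
  have h1 : ∀ (i : Fin n) (ξ : E) (ζ : PiLp 2 (fun _ : Fin n => E)),
      inner ℂ (WithLp.toLp 2 (Pi.single i ξ) : PiLp 2 (fun _ : Fin n => E)) ζ =
        inner ℂ ξ (ζ i) := by
    intro i ξ ζ
    rw [PiLp.inner_apply, Finset.sum_eq_single i] <;> simp +contextual
  have h2 : inner ℂ (entry (star Z) i j ξ) η =
      inner ℂ ((star Z) (WithLp.toLp 2 (Pi.single j ξ)))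
        (WithLp.toLp 2 (Pi.single i η) : PiLp 2 (fun _ : Fin n => E)) := by
    rw [entry_apply, ← inner_conj_symm, ← h1, inner_conj_symm]
  have h3 : inner ℂ ((star Z) (WithLp.toLp 2 (Pi.single j ξ)))
        (WithLp.toLp 2 (Pi.single i η) : PiLp 2 (fun _ : Fin n => E)) = inner ℂ
      (WithLp.toLp 2 (Pi.single j ξ) : PiLp 2 (fun _ : Fin n => E))
      (Z (WithLp.toLp 2 (Pi.single i η))) := ContinuousLinearMap.adjoint_inner_left Z _ _
  rw [h2, h3, h1]
  rfl

/-- The `*`-algebra `Mₙ(D)` of operators on `Eⁿ`. -/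
def matrixStarSubalgebra (D : StarSubalgebra ℂ (E →L[ℂ] E)) (n : ℕ) :
    StarSubalgebra ℂ (PiLp 2 (fun _ : Fin n => E) →L[ℂ] PiLp 2 (fun _ : Fin n => E)) where
  carrier := {Z | ∀ i j, entry Z i j ∈ D}
  mul_mem' {Y Z} hY hZ i j := by
    rw [entry_mul, Matrix.mul_apply]
    exact sum_mem fun k _ => mul_mem (hY i k) (hZ k j)
  add_mem' {Y Z} hY hZ i j := by
    rw [entry_add]
    exact add_mem (hY i j) (hZ i j)
  algebraMap_mem' c i j := by
    rw [entry_algebraMap]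
    split_ifs
    · exact algebraMap_mem D c
    · exact zero_mem D
  star_mem' {Z} hZ i j := by
    rw [entry_star]
    exact star_mem (hZ j i)

theorem commute_matrixOp_diagonal
    {Z : PiLp 2 (fun _ : Fin n => E) →L[ℂ] PiLp 2 (fun _ : Fin n => E)}
    {a : E →L[ℂ] E} :
    Commute (matrixOp (Matrix.diagonal fun _ => a)) Z ↔ ∀ i j, Commute a (entry Z i j) := by
  constructor
  · intro h i j
    have h1 := congrArg entry h.eq
    rw [entry_mul, entry_mul, entry_matrixOp] at h1
    have h2 := congrFun (congrFun h1 i) j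
    rwa [Matrix.diagonal_mul, Matrix.mul_diagonal] at h2
  · intro h
    rw [Commute, SemiconjBy, ← matrixOp_entry Z, ← matrixOp_mul, ← matrixOp_mul]
    congr 1
    refine Matrix.ext fun i j => ?_
    rw [Matrix.diagonal_mul, Matrix.mul_diagonal]
    exact h i j

end MatrixOperators

/-! ### The double commutant theorem -/

section Density

variable {E : Type*} [NormedAddCommGroup E] [InnerProductSpace ℂ E] [CompleteSpace E]

open Filter Topology

/-- `T` belongs to the double commutant of `D`. -/
def InBicommutant (D : StarSubalgebra ℂ (E →L[ℂ] E)) (T : E →L[ℂ] E) : Prop :=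
  ∀ z : E →L[ℂ] E, (∀ a ∈ D, Commute a z) → Commute T z

/-- The matrices over the double commutant of `D` are in the double commutant of `Mₙ(D)`. -/
theorem InBicommutant.matrixOp {D : StarSubalgebra ℂ (E →L[ℂ] E)} {n : ℕ}
    {X : Matrix (Fin n) (Fin n) (E →L[ℂ] E)} (hX : ∀ i j, InBicommutant D (X i j)) :
    InBicommutant (matrixStarSubalgebra D n) (matrixOp X) := by
  intro Z hZ
  have h1 : ∀ a ∈ D, ∀ i j, Commute a (entry Z i j) := by
    intro a ha
    refine commute_matrixOp_diagonal.1 (hZ _ fun i j => ?_)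
    rw [entry_matrixOp, Matrix.diagonal_apply]
    split_ifs
    · exact ha
    · exact zero_mem D
  obtain ⟨y, hy⟩ : entry Z ∈ Set.range (Matrix.scalar (Fin n)) := by
    refine Matrix.mem_range_scalar_of_commute_single fun i j _ => ?_
    have h2 := hZ (VNTensor.matrixOp (Matrix.single i j 1)) fun k l => by
      rw [entry_matrixOp, Matrix.single_apply]
      split_ifs
      · exact one_mem D
      · exact zero_mem D
    have h3 := congrArg entry h2.eq
    rwa [entry_mul, entry_mul, entry_matrixOp] at h3
  have h2 : ∀ i j, Commute (X i j) y := fun i j => by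
    refine hX i j y fun a ha => ?_
    have := h1 a ha i i
    rwa [← hy, Matrix.scalar_apply, Matrix.diagonal_apply_eq] at this
  rw [Commute, SemiconjBy, ← matrixOp_entry Z, ← matrixOp_mul, ← matrixOp_mul, ← hy]
  congr 1
  refine Matrix.ext fun i j => ?_
  rw [Matrix.scalar_apply, Matrix.mul_diagonal, Matrix.diagonal_mul]
  exact h2 i j

theorem InBicommutant.star {D : StarSubalgebra ℂ (E →L[ℂ] E)} {T : E →L[ℂ] E}
    (hT : InBicommutant D T) : InBicommutant D (star T) := by
  intro z hz
  have h := hT (Star.star z) fun a ha => by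
    have := (hz (Star.star a) (star_mem ha)).star_star
    rwa [star_star] at this
  have := h.star_star
  rwa [star_star] at this

/-- Approximation at finitely many points at a time, within `s`, gives a filter along which `f`
converges pointwise. -/
theorem exists_filter_of_finite_approx {α κ F : Type*} [NormedAddCommGroup F] {f : α → κ → F}
    {t : κ → F} {s : Set α}
    (h : ∀ (I : Finset κ) (ε : ℝ), 0 < ε → ∃ a ∈ s, ∀ k ∈ I, ‖f a k - t k‖ < ε) :
    ∃ l : Filter α, l.NeBot ∧ (∀ᶠ a in l, a ∈ s) ∧ ∀ k, Tendsto (fun a => f a k) l (𝓝 (t k)) := by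
  refine ⟨comap f (𝓝 t) ⊓ 𝓟 s, ?_, ?_, fun k => ?_⟩
  · rw [inf_principal_neBot_iff]
    rintro U ⟨V, hV, hVU⟩
    rw [nhds_pi, mem_pi] at hV
    obtain ⟨I, hI, W, hW, hWV⟩ := hV
    have h1 : ∀ᶠ ε in 𝓝[>] (0 : ℝ), ∀ k ∈ I, Metric.ball (t k) ε ⊆ W k := by
      rw [eventually_all_finite hI]
      intro k _
      obtain ⟨δ, hδ, hδW⟩ := Metric.mem_nhds_iff.1 (hW k)
      filter_upwards [Ioo_mem_nhdsGT hδ] with ε hε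
      exact (Metric.ball_subset_ball hε.2.le).trans hδW
    obtain ⟨ε, hεW, hε⟩ := (h1.and self_mem_nhdsWithin).exists
    obtain ⟨a, has, ha⟩ := h hI.toFinset ε hε
    refine ⟨a, hVU (hWV fun k hk => hεW k hk ?_), has⟩
    rw [Metric.mem_ball, dist_eq_norm]
    exact ha k (hI.mem_toFinset.2 hk)
  · exact mem_inf_of_right (mem_principal_self s)
  · exact (tendsto_pi_nhds.1 (tendsto_comap.mono_left inf_le_left)) k

theorem starProjection_commute_of_invariant {K : Submodule ℂ E} [K.HasOrthogonalProjection]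
    {a : E →L[ℂ] E} (h : ∀ ξ ∈ K, a ξ ∈ K) (h' : ∀ ξ ∈ K, (star a) ξ ∈ K) :
    Commute a K.starProjection := by
  ext ξ
  rw [mul_apply_eq_comp, mul_apply_eq_comp]
  refine (Submodule.eq_starProjection_of_mem_of_inner_eq_zero
    (h _ (Submodule.starProjection_apply_mem _ _)) fun w hw => ?_).symm
  rw [← map_sub]
  have : inner ℂ (a (ξ - K.starProjection ξ)) w = inner ℂ (ξ - K.starProjection ξ) ((star a) w) :=
    (ContinuousLinearMap.adjoint_inner_right a _ _).symm
  rw [this]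
  exact Submodule.starProjection_inner_eq_zero _ _ (h' w hw)

/-- The double commutant theorem: `D` is strongly dense in its double commutant. -/
theorem exists_strong_approx {D : StarSubalgebra ℂ (E →L[ℂ] E)} {T : E →L[ℂ] E}
    (hT : InBicommutant D T) :
    ∃ l : Filter (E →L[ℂ] E), l.NeBot ∧ (∀ᶠ a in l, a ∈ D) ∧
      ∀ ξ, Tendsto (fun a => a ξ) l (𝓝 (T ξ)) := by
  refine exists_filter_of_finite_approx (f := fun (a : E →L[ℂ] E) ξ => a ξ) (s := (D : Set _))
    fun I ε hε => ?_
  let ξ : Fin I.card → E := fun i => I.equivFin.symm i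
  let Ξ : PiLp 2 (fun _ : Fin I.card => E) := WithLp.toLp 2 ξ
  let δ : (E →L[ℂ] E) → (PiLp 2 (fun _ : Fin I.card => E) →L[ℂ] PiLp 2 (fun _ : Fin I.card => E)) :=
    fun a => matrixOp (Matrix.diagonal fun _ => a)
  have hδ : ∀ a ζ i, δ a ζ i = a (ζ i) := fun a ζ i => by
    simp only [δ]
    rw [matrixOp_apply, Finset.sum_eq_single i] <;> simp +contextual [Matrix.diagonal_apply]
    intro j hij
    simp [Ne.symm hij]
  let K₀ : Submodule ℂ (PiLp 2 (fun _ : Fin I.card => E)) :=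
    { carrier := {ζ | ∃ a ∈ D, ζ = δ a Ξ}
      zero_mem' := ⟨0, zero_mem D, by ext i; simp [hδ]⟩
      add_mem' := by
        rintro _ _ ⟨a, ha, rfl⟩ ⟨b, hb, rfl⟩
        exact ⟨a + b, add_mem ha hb, by ext i; simp [hδ]⟩
      smul_mem' := by
        rintro c _ ⟨a, ha, rfl⟩
        exact ⟨c • a, D.smul_mem ha c, by ext i; simp [hδ]⟩ }
  have hinv : ∀ a ∈ D, ∀ ζ ∈ K₀.topologicalClosure, δ a ζ ∈ K₀.topologicalClosure := by
    intro a ha ζ hζ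
    have hle : K₀ ≤ K₀.topologicalClosure.comap
        (δ a : PiLp 2 (fun _ : Fin I.card => E) →ₗ[ℂ] PiLp 2 (fun _ : Fin I.card => E)) := by
      rintro _ ⟨b, hb, rfl⟩
      exact K₀.le_topologicalClosure ⟨a * b, mul_mem ha hb, by ext i; simp [hδ]⟩
    exact Submodule.topologicalClosure_minimal _ hle
      (K₀.isClosed_topologicalClosure.preimage (δ a).continuous) hζ
  have : CompleteSpace K₀.topologicalClosure :=
    K₀.isClosed_topologicalClosure.completeSpace_coe
  have hstar : ∀ a, star (δ a) = δ (star a) := fun a => by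
    rw [← matrixOp_entry (star (δ a))]
    simp only [δ]
    congr 1
    refine Matrix.ext fun i j => ?_
    rw [entry_star, entry_matrixOp]
    by_cases hij : i = j
    · subst hij; simp
    · simp [hij, Ne.symm hij]
  have hcomm : ∀ a ∈ D, Commute (δ a) K₀.topologicalClosure.starProjection := fun a ha =>
    starProjection_commute_of_invariant (hinv a ha) (by
      rw [hstar]; exact hinv _ (star_mem ha))
  have hTcomm : Commute (δ T) K₀.topologicalClosure.starProjection :=
    commute_matrixOp_diagonal.2 fun i j =>
      hT _ fun a ha => commute_matrixOp_diagonal.1 (hcomm a ha) i j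
  have hΞ : Ξ ∈ K₀.topologicalClosure :=
    K₀.le_topologicalClosure ⟨1, one_mem D, by ext i; simp [hδ]⟩
  have hTΞ : δ T Ξ ∈ K₀.topologicalClosure := by
    have h1 := congrArg (fun S : _ →L[ℂ] _ => S Ξ) hTcomm.eq
    simp only [mul_apply_eq_comp] at h1
    rw [Submodule.starProjection_eq_self_iff.2 hΞ] at h1
    rw [h1]
    exact Submodule.starProjection_apply_mem _ _
  obtain ⟨_, ⟨a, ha, rfl⟩, hdist⟩ := Metric.mem_closure_iff.1 hTΞ ε hε
  refine ⟨a, ha, fun k hk => ?_⟩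
  have h1 : (δ a Ξ - δ T Ξ) (I.equivFin ⟨k, hk⟩) = a k - T k := by
    simp [hδ, Ξ, ξ]
  rw [← h1]
  rw [dist_comm, dist_eq_norm] at hdist
  exact (PiLp.norm_apply_le _ _).trans_lt hdist

theorem mem_closure_of_real_inner_eq_zero {F : Type*} [NormedAddCommGroup F]
    [InnerProductSpace ℝ F] [CompleteSpace F] {K : Submodule ℝ F} {x : F}
    (h : ∀ g, (∀ s ∈ K, inner ℝ g s = 0) → inner ℝ g x = 0) : x ∈ closure (K : Set F) := by
  change x ∈ K.topologicalClosure
  rw [← Submodule.orthogonal_orthogonal_eq_closure, Submodule.mem_orthogonal]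
  exact fun g hg => h g fun s hs => (Submodule.mem_orthogonal' _ _).1 hg s hs

/-- A real subspace of a complex Hilbert space is dense in the annihilator of its annihilator, for
the real inner product. -/
theorem mem_closure_of_re_inner_eq_zero {S : Set E} (h0 : 0 ∈ S)
    (hadd : ∀ x ∈ S, ∀ y ∈ S, x + y ∈ S) (hsmul : ∀ (c : ℝ), ∀ x ∈ S, (c : ℂ) • x ∈ S) {x : E}
    (h : ∀ g, (∀ s ∈ S, (inner ℂ g s).re = 0) → (inner ℂ g x).re = 0) : x ∈ closure S :=
  letI : InnerProductSpace ℝ E := InnerProductSpace.complexToReal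
  mem_closure_of_real_inner_eq_zero (F := E) (K :=
    { carrier := S
      zero_mem' := h0
      add_mem' := fun {x y} hx hy => hadd x hx y hy
      smul_mem' := fun c x hx => hsmul c x hx }) fun g hg => h g hg

/-- `D` is dense in its double commutant for the strong-`*` topology. A real-linear functional
`a ↦ Re (∑ ⟪gₖ, a ξₖ⟫ + ∑ ⟪gₗ, a* ηₗ⟫)` is weakly continuous in `a`, so by strong density it
vanishes on the double commutant when it vanishes on `D`. -/
theorem exists_strongStar_approx {D : StarSubalgebra ℂ (E →L[ℂ] E)} {T : E →L[ℂ] E}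
    (hT : InBicommutant D T) :
    ∃ l : Filter (E →L[ℂ] E), l.NeBot ∧ (∀ᶠ a in l, a ∈ D) ∧
      (∀ ξ, Tendsto (fun a => a ξ) l (𝓝 (T ξ))) ∧
      ∀ ξ, Tendsto (fun a => (star a) ξ) l (𝓝 ((star T) ξ)) := by
  let f : (E →L[ℂ] E) → E ⊕ E → E := fun a => Sum.elim (fun ξ => a ξ) fun ξ => (star a) ξ
  suffices h : ∃ l : Filter (E →L[ℂ] E), l.NeBot ∧ (∀ᶠ a in l, a ∈ (D : Set (E →L[ℂ] E))) ∧
      ∀ k, Tendsto (fun a => f a k) l (𝓝 (f T k)) by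
    obtain ⟨l, hl, hD, hk⟩ := h
    exact ⟨l, hl, hD, fun ξ => hk (Sum.inl ξ), fun ξ => hk (Sum.inr ξ)⟩
  refine exists_filter_of_finite_approx fun I ε hε => ?_
  let Ψ : (E →L[ℂ] E) → PiLp 2 (fun _ : I => E) := fun a => WithLp.toLp 2 fun k => f a k
  have hΨadd : ∀ a b, Ψ (a + b) = Ψ a + Ψ b := by
    intro a b
    ext ⟨k, hk⟩
    rcases k with ξ | ξ <;> simp [Ψ, f]
  have hΨsmul : ∀ (c : ℝ) a, Ψ ((c : ℂ) • a) = (c : ℂ) • Ψ a := by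
    intro c a
    ext ⟨k, hk⟩
    rcases k with ξ | ξ <;> simp [Ψ, f]
  have hmem : Ψ T ∈ closure (Ψ '' D) := by
    have hΨ0 : Ψ 0 = 0 := by simpa using hΨsmul 0 0
    refine mem_closure_of_re_inner_eq_zero (S := Ψ '' D) ⟨0, zero_mem D, hΨ0⟩ ?_ ?_ ?_
    · rintro _ ⟨a, ha, rfl⟩ _ ⟨b, hb, rfl⟩
      exact ⟨a + b, add_mem ha hb, hΨadd a b⟩
    · rintro c _ ⟨a, ha, rfl⟩
      exact ⟨(c : ℂ) • a, D.smul_mem ha _, hΨsmul c a⟩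
    intro g hg
    obtain ⟨l, hl, hD, hlim⟩ := exists_strong_approx hT
    have hre : ∀ a, (inner ℂ g (Ψ a)).re = ∑ k : I, (inner ℂ (g k) (f a k)).re := fun a => by
      rw [PiLp.inner_apply, Complex.re_sum]
    have h1 : ∀ k : I, Tendsto (fun a => (inner ℂ (g k) (f a k)).re) l
        (𝓝 (inner ℂ (g k) (f T k)).re) := by
      rintro ⟨k, hk⟩
      rcases k with ξ | ξ
      · exact (Complex.continuous_re.tendsto _).comp (tendsto_const_nhds.inner (hlim ξ))
      · have h2 : ∀ a : E →L[ℂ] E, (inner ℂ (g ⟨Sum.inr ξ, hk⟩) ((star a) ξ)).re =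
            (inner ℂ (a (g ⟨Sum.inr ξ, hk⟩)) ξ).re := fun a =>
          congrArg Complex.re (ContinuousLinearMap.adjoint_inner_right a _ _)
        simp only [f, Sum.elim_inr, h2]
        exact (Complex.continuous_re.tendsto _).comp ((hlim _).inner tendsto_const_nhds)
    have h2 : Tendsto (fun a => (inner ℂ g (Ψ a)).re) l (𝓝 (inner ℂ g (Ψ T)).re) := by
      simp only [hre]
      exact tendsto_finsetSum _ fun k _ => h1 k
    have h3 : Tendsto (fun a => (inner ℂ g (Ψ a)).re) l (𝓝 0) := by
      refine tendsto_const_nhds.congr' ?_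
      filter_upwards [hD] with a ha
      exact (hg _ ⟨a, ha, rfl⟩).symm
    exact tendsto_nhds_unique h2 h3
  obtain ⟨_, ⟨a, ha, rfl⟩, hdist⟩ := Metric.mem_closure_iff.1 hmem ε hε
  refine ⟨a, ha, fun k hk => ?_⟩
  rw [dist_comm, dist_eq_norm] at hdist
  exact (PiLp.norm_apply_le (Ψ a - Ψ T) ⟨k, hk⟩).trans_lt hdist

end Density

/-! ### Kaplansky's density theorem -/

section Kaplansky

variable {E : Type*} [NormedAddCommGroup E] [InnerProductSpace ℂ E] [CompleteSpace E]

open Filter Topology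

/-- The resolvent `(1 + a* a)⁻¹`. The absolute value, harmless on the spectrum of `a* a`, makes the
function continuous on all of `ℝ`. -/
def resolventStarMul (a : E →L[ℂ] E) : E →L[ℂ] E := cfc (fun t : ℝ => (1 + |t|)⁻¹) (star a * a)

theorem continuous_one_add_abs_inv : Continuous fun t : ℝ => (1 + |t|)⁻¹ :=
  (continuous_const.add continuous_abs).inv₀ fun t =>
    (show 0 < 1 + |t| by positivity).ne'

theorem one_add_mul_resolventStarMul (a : E →L[ℂ] E) :
    (1 + star a * a) * resolventStarMul a = 1 := by
  have hsa : IsSelfAdjoint (star a * a) := .star_mul_self a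
  have h1 : cfc (fun t : ℝ => 1 + t) (star a * a) = 1 + star a * a := by
    rw [cfc_const_add 1 (fun t => t) (star a * a), cfc_id' ℝ (star a * a)]
    simp
  rw [← h1, resolventStarMul, ← cfc_mul _ _ _ (by fun_prop)
    continuous_one_add_abs_inv.continuousOn, ← cfc_const_one ℝ (star a * a)]
  refine cfc_congr fun t ht => ?_
  have ht0 : 0 ≤ t := spectrum_nonneg_of_nonneg (star_mul_self_nonneg a) ht
  have : 1 + t ≠ 0 := by positivity
  simp only [abs_of_nonneg ht0]
  exact mul_inv_cancel₀ this

theorem resolventStarMul_mul_one_add (a : E →L[ℂ] E) :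
    resolventStarMul a * (1 + star a * a) = 1 := by
  have h : Commute (1 + star a * a) (resolventStarMul a) :=
    (Commute.one_left _).add_left ((Commute.refl (star a * a)).cfc_real _).symm
  rw [← h.eq, one_add_mul_resolventStarMul]

theorem norm_sq_one_add_apply (a : E →L[ℂ] E) (ζ : E) :
    ‖(1 + star a * a) ζ‖ ^ 2 = ‖ζ‖ ^ 2 + 2 * ‖a ζ‖ ^ 2 + ‖(star a) (a ζ)‖ ^ 2 := by
  have h1 : (1 + star a * a) ζ = ζ + (star a) (a ζ) := rfl
  have h2 : RCLike.re (inner ℂ ζ ((star a) (a ζ))) = ‖a ζ‖ ^ 2 := by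
    have : inner ℂ ζ ((star a) (a ζ)) = inner ℂ (a ζ) (a ζ) :=
      ContinuousLinearMap.adjoint_inner_right a _ _
    rw [this]; exact inner_self_eq_norm_sq _
  rw [h1, @norm_add_sq ℂ, h2]

theorem norm_resolventStarMul_apply_le (a : E →L[ℂ] E) (ξ : E) :
    ‖resolventStarMul a ξ‖ ≤ ‖ξ‖ := by
  have h1 := norm_sq_one_add_apply a (resolventStarMul a ξ)
  rw [← mul_apply_eq_comp, one_add_mul_resolventStarMul, one_apply_eq_self] at h1
  refine (sq_le_sq₀ (norm_nonneg _) (norm_nonneg _)).1 ?_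
  rw [h1, add_assoc]
  exact le_add_of_nonneg_right (by positivity)

/-- The transform `a ↦ 2a(1 + a* a)⁻¹` onto the unit ball. -/
def kaplanskyTransform (a : E →L[ℂ] E) : E →L[ℂ] E := (2 : ℂ) • (a * resolventStarMul a)

theorem norm_kaplanskyTransform_apply_le (a : E →L[ℂ] E) (ξ : E) :
    ‖kaplanskyTransform a ξ‖ ≤ ‖ξ‖ := by
  have h1 := norm_sq_one_add_apply a (resolventStarMul a ξ)
  rw [← mul_apply_eq_comp, one_add_mul_resolventStarMul, one_apply_eq_self] at h1
  set ζ := resolventStarMul a ξ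
  have h2 : ‖kaplanskyTransform a ξ‖ = 2 * ‖a ζ‖ := by
    rw [kaplanskyTransform, smul_apply, norm_smul, mul_apply_eq_comp]; simp [ζ]
  have h3 : ‖a ζ‖ ^ 2 ≤ ‖ζ‖ * ‖(star a) (a ζ)‖ := by
    have : inner ℂ ζ ((star a) (a ζ)) = inner ℂ (a ζ) (a ζ) :=
      ContinuousLinearMap.adjoint_inner_right a _ _
    have h4 := norm_inner_le_norm (𝕜 := ℂ) ζ ((star a) (a ζ))
    rw [this, inner_self_eq_norm_sq_to_K] at h4
    simpa using h4
  rw [h2]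
  refine (sq_le_sq₀ (by positivity) (norm_nonneg _)).1 ?_
  nlinarith [sq_nonneg (‖ζ‖ - ‖(star a) (a ζ)‖)]

theorem kaplanskyTransform_mem_closure {D : StarSubalgebra ℂ (E →L[ℂ] E)} {a : E →L[ℂ] E}
    (ha : a ∈ D) : kaplanskyTransform a ∈ D.topologicalClosure := by
  have ha' := D.le_topologicalClosure ha
  have h1 : resolventStarMul a ∈ D.topologicalClosure :=
    cfc_mem (𝕜 := ℝ) (𝕜' := ℂ) (hs := D.isClosed_topologicalClosure) _
      (mul_mem (star_mem ha') ha')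
  exact D.topologicalClosure.smul_mem (mul_mem ha' h1) _

/-- The transform is strongly continuous where `a` and `a*` converge strongly. -/
theorem norm_kaplanskyTransform_sub_le {a S X : E →L[ℂ] E}
    (hX : X * (1 + star S * S) = (2 : ℂ) • S) (ζ : E) :
    ‖kaplanskyTransform a ((1 + star S * S) ζ) - X ((1 + star S * S) ζ)‖ ≤
      2 * ‖a ζ - S ζ‖ + ‖(star a) (S ζ) - (star S) (S ζ)‖ := by
  set R := resolventStarMul (star a) with hR
  have hRa : R * a = a * resolventStarMul a := by
    have h1 : R * (1 + a * star a) = 1 := by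
      have := resolventStarMul_mul_one_add (star a)
      rwa [star_star] at this
    have h2 : (1 + a * star a) * a = a * (1 + star a * a) := by noncomm_ring
    calc R * a = R * (a * ((1 + star a * a) * resolventStarMul a)) := by
          rw [one_add_mul_resolventStarMul, mul_one]
      _ = R * ((1 + a * star a) * a) * resolventStarMul a := by rw [h2]; simp only [mul_assoc]
      _ = a * resolventStarMul a := by rw [← mul_assoc R, h1, one_mul]
  have hR1 : R * (1 + a * star a) = 1 := by
    have := resolventStarMul_mul_one_add (star a)
    rwa [star_star] at this
  have hkey : kaplanskyTransform a * (1 + star S * S) - X * (1 + star S * S) =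
      (2 : ℂ) • (R * (a - S)) + kaplanskyTransform a * ((star S - star a) * S) := by
    have e1 : S = R * (1 + a * star a) * S := by rw [hR1, one_mul]
    rw [hX, kaplanskyTransform, ← hRa]
    nth_rw 3 [e1]
    simp only [smul_mul_assoc, ← smul_sub, ← smul_add]
    congr 1
    noncomm_ring
  have h1 := congrArg (fun T : E →L[ℂ] E => T ζ) hkey
  simp only [sub_apply, add_apply, smul_apply, mul_apply_eq_comp] at h1
  have h3 : kaplanskyTransform a ((1 + star S * S) ζ) - X ((1 + star S * S) ζ) =
      (2 : ℂ) • R (a ζ - S ζ) + kaplanskyTransform a ((star S) (S ζ) - (star a) (S ζ)) := h1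
  rw [h3]
  refine (norm_add_le _ _).trans (add_le_add ?_ ?_)
  · rw [norm_smul]
    simpa using norm_resolventStarMul_apply_le (star a) (a ζ - S ζ)
  · rw [norm_sub_rev ((star a) (S ζ))]
    exact norm_kaplanskyTransform_apply_le _ _

theorem InBicommutant.cfc {D : StarSubalgebra ℂ (E →L[ℂ] E)} {T : E →L[ℂ] E}
    (hT : InBicommutant D T) (hsa : IsSelfAdjoint T) (g : ℝ → ℝ) : InBicommutant D (cfc g T) :=
  fun z hz => Commute.cfc (hT z hz) (by rw [hsa.star_eq]; exact hT z hz) g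

theorem InBicommutant.mul {D : StarSubalgebra ℂ (E →L[ℂ] E)} {S T : E →L[ℂ] E}
    (hS : InBicommutant D S) (hT : InBicommutant D T) : InBicommutant D (S * T) :=
  fun z hz => (hS z hz).mul_left (hT z hz)

/-- A contraction `X` is of the form `2S(1 + S* S)⁻¹`. -/
theorem exists_mul_one_add_eq {D : StarSubalgebra ℂ (E →L[ℂ] E)} {X : E →L[ℂ] E}
    (hX : InBicommutant D X) (hX1 : ‖X‖ ≤ 1) :
    ∃ S, InBicommutant D S ∧ X * (1 + star S * S) = (2 : ℂ) • S := by
  have hsa : IsSelfAdjoint (star X * X) := .star_mul_self X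
  let g : ℝ → ℝ := fun t => (1 + √(1 - t))⁻¹
  have hg : Continuous g := by
    refine Continuous.inv₀ (by fun_prop) fun t => ?_
    exact (show 0 < 1 + √(1 - t) by positivity).ne'
  set G := cfc g (star X * X) with hG
  have hGsa : IsSelfAdjoint G := cfc_predicate _ _
  refine ⟨X * G, hX.mul ((hX.star.mul hX).cfc hsa g), ?_⟩
  have h1 : 1 + G * (star X * X) * G = (2 : ℂ) • G := by
    have e1 : G * (star X * X) * G = cfc (fun t => g t * t * g t) (star X * X) := by
      rw [cfc_mul (fun t => g t * t) g _ (hg.mul continuous_id).continuousOn hg.continuousOn,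
        cfc_mul g (fun t => t) _ hg.continuousOn continuousOn_id, cfc_id' ℝ (star X * X)]
    have e2 : (2 : ℂ) • G = cfc (fun t => 2 * g t) (star X * X) := by
      rw [cfc_const_mul 2 g _ hg.continuousOn, ← hG, ← Complex.coe_smul]
      norm_num
    rw [e1, e2, ← cfc_const_one ℝ (star X * X), ← cfc_add (star X * X) (fun _ => 1)
      (fun t => g t * t * g t) continuousOn_const ((hg.mul continuous_id).mul hg).continuousOn]
    refine cfc_congr fun t ht => ?_
    have ht1 : t ≤ 1 := by
      have h2 : ‖t‖ ≤ ‖star X * X‖ := by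
        have : Nontrivial (E →L[ℂ] E) := by
          by_contra hnt
          rw [not_nontrivial_iff_subsingleton] at hnt
          exact ht (isUnit_of_subsingleton _)
        exact spectrum.norm_le_norm_of_mem ht
      rw [CStarRing.norm_star_mul_self] at h2
      have h3 : ‖X‖ * ‖X‖ ≤ 1 := mul_le_one₀ hX1 (norm_nonneg _) hX1
      exact (le_abs_self t).trans (h2.trans h3)
    have hs : √(1 - t) ^ 2 = 1 - t := Real.sq_sqrt (by linarith)
    have hs0 : 0 < 1 + √(1 - t) := by positivity
    simp only [g]
    field_simp
    linarith
  rw [star_mul, hGsa.star_eq]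
  have h2 : G * star X * (X * G) = G * (star X * X) * G := by simp only [mul_assoc]
  rw [h2, h1, mul_smul_comm]

/-- Kaplansky's density theorem, up to a factor `2` in the norm. -/
theorem exists_bounded_strong_approx {D : StarSubalgebra ℂ (E →L[ℂ] E)} {T : E →L[ℂ] E}
    (hT : InBicommutant D T) :
    ∃ l : Filter (E →L[ℂ] E), l.NeBot ∧ (∀ᶠ a in l, a ∈ D ∧ ‖a‖ ≤ 2 * ‖T‖) ∧
      ∀ ξ, Tendsto (fun a => a ξ) l (𝓝 (T ξ)) := by
  rcases eq_or_ne T 0 with rfl | hT0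
  · exact ⟨pure (0 : E →L[ℂ] E), inferInstance, by simp [zero_mem], fun ξ => tendsto_pure_nhds _ _⟩
  have hTn : 0 < ‖T‖ := norm_pos_iff.2 hT0
  set X : E →L[ℂ] E := ((‖T‖⁻¹ : ℝ) : ℂ) • T with hXdef
  have hX : InBicommutant D X := fun z hz => (hT z hz).smul_left _
  have hX1 : ‖X‖ ≤ 1 := by
    rw [hXdef, norm_smul]
    simp [hTn.ne']
  have hTX : T = (‖T‖ : ℂ) • X := by
    rw [hXdef, smul_smul, ← Complex.ofReal_mul, mul_inv_cancel₀ hTn.ne']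
    simp
  obtain ⟨S, hS, hXS⟩ := exists_mul_one_add_eq hX hX1
  have hsurj : ∀ ξ, (1 + star S * S) (resolventStarMul S ξ) = ξ := fun ξ => by
    rw [← mul_apply_eq_comp, one_add_mul_resolventStarMul, one_apply_eq_self]
  obtain ⟨l, hl, hD, hlim, hlim'⟩ := exists_strongStar_approx hS
  have hlimX : ∀ ξ, Tendsto (fun a => kaplanskyTransform a ξ) l (𝓝 (X ξ)) := by
    intro ξ
    rw [tendsto_iff_norm_sub_tendsto_zero]
    set ζ := resolventStarMul S ξ with hζ
    have h1 : Tendsto (fun a : E →L[ℂ] E => 2 * ‖a ζ - S ζ‖ +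
        ‖(star a) (S ζ) - (star S) (S ζ)‖) l (𝓝 0) := by
      have e1 := (tendsto_iff_norm_sub_tendsto_zero.1 (hlim ζ)).const_mul 2
      have e2 := tendsto_iff_norm_sub_tendsto_zero.1 (hlim' (S ζ))
      simpa using e1.add e2
    refine squeeze_zero (fun _ => norm_nonneg _) (fun a => ?_) h1
    have := norm_kaplanskyTransform_sub_le (a := a) hXS ζ
    rwa [hζ, hsurj] at this
  obtain ⟨l', hl', hD', hlim'⟩ := exists_filter_of_finite_approx
    (f := fun (a : E →L[ℂ] E) ξ => a ξ) (t := fun ξ => T ξ)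
    (s := {a | a ∈ D ∧ ‖a‖ ≤ 2 * ‖T‖}) fun I ε hε => by
    have hε' : 0 < ε / ‖T‖ := by positivity
    obtain ⟨a, haD, ha⟩ : ∃ a ∈ D, ∀ ξ ∈ I, ‖kaplanskyTransform a ξ - X ξ‖ < ε / ‖T‖ := by
      have h1 : ∀ᶠ a in l, ∀ ξ ∈ I, ‖kaplanskyTransform a ξ - X ξ‖ < ε / ‖T‖ := by
        rw [eventually_all_finset]
        intro ξ _
        exact (tendsto_iff_norm_sub_tendsto_zero.1 (hlimX ξ)).eventually_lt_const hε'
      obtain ⟨a, ha, ha'⟩ := (hD.and h1).exists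
      exact ⟨a, ha, ha'⟩
    set Y := kaplanskyTransform a
    have hY : Y ∈ closure (D : Set (E →L[ℂ] E)) := kaplanskyTransform_mem_closure haD
    have hY1 : ‖Y‖ ≤ 1 := Y.opNorm_le_bound zero_le_one fun ξ => by
      rw [one_mul]; exact norm_kaplanskyTransform_apply_le a ξ
    have h2 : ∀ᶠ b in 𝓝 Y, ‖b‖ < 2 ∧ ∀ ξ ∈ I, ‖b ξ - X ξ‖ < ε / ‖T‖ := by
      refine ((continuous_norm.tendsto Y).eventually_lt_const (by linarith)).and ?_
      rw [eventually_all_finset]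
      intro ξ hξ
      have hc : Continuous fun b : E →L[ℂ] E => ‖b ξ - X ξ‖ := by fun_prop
      exact (hc.tendsto Y).eventually_lt_const (ha ξ hξ)
    obtain ⟨b, hbD, hb2, hbI⟩ := ((mem_closure_iff_frequently.1 hY).and_eventually h2).exists
    refine ⟨(‖T‖ : ℂ) • b, ⟨D.smul_mem hbD _, ?_⟩, fun ξ hξ => ?_⟩
    · rw [norm_smul]
      simp only [Complex.norm_real, norm_norm]
      nlinarith
    · have h3 : ((‖T‖ : ℂ) • b) ξ - T ξ = (‖T‖ : ℂ) • (b ξ - X ξ) := by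
        conv_lhs => rw [hTX]
        simp only [smul_apply, smul_sub]
        rw [← hTX]
      rw [h3, norm_smul]
      have h4 := hbI ξ hξ
      rw [lt_div_iff₀ hTn] at h4
      simpa [mul_comm] using h4
  exact ⟨l', hl', hD', hlim'⟩

end Kaplansky

/-! ### Norms of matrices and matrix units -/

section MatrixUnitNorm

variable {E : Type*} [NormedAddCommGroup E] [InnerProductSpace ℂ E] [CompleteSpace E]
  {ι : Type*} [Fintype ι] [DecidableEq ι] {f : ι → ι → E →L[ℂ] E} {n : ℕ}

theorem IsMatrixUnits.inner_apply_apply (hf : IsMatrixUnits f) (i j k l : ι) (ξ η : E) :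
    inner ℂ (f i j ξ) (f k l η) = if i = k then inner ℂ ξ (f j l η) else 0 := by
  have h1 : inner ℂ (f i j ξ) (f k l η) = inner ℂ ξ ((Star.star (f i j) * f k l) η) :=
    (ContinuousLinearMap.adjoint_inner_right (f i j) _ _).symm
  rw [h1, hf.star, hf.mul]
  split_ifs <;> simp

/-- The operators `f k l`, for fixed `k`, form an isometry of the Hilbert space into a direct sum of
its copies. -/
theorem IsMatrixUnits.sum_norm_sq (hf : IsMatrixUnits f) (k : ι) (ξ : E) :
    ∑ l, ‖f k l ξ‖ ^ 2 = ‖ξ‖ ^ 2 := by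
  have h1 : ∀ l, (‖f k l ξ‖ ^ 2 : ℂ) = inner ℂ ξ (f l l ξ) := fun l => by
    have h2 := inner_self_eq_norm_sq_to_K (𝕜 := ℂ) (f k l ξ)
    rw [hf.inner_apply_apply, if_pos rfl] at h2
    rw [h2]; rfl
  have h2 : ((∑ l, ‖f k l ξ‖ ^ 2 : ℝ) : ℂ) = ((‖ξ‖ ^ 2 : ℝ) : ℂ) := by
    push_cast
    simp only [h1]
    rw [← inner_sum, ← sum_apply, hf.sum, one_apply_eq_self, inner_self_eq_norm_sq_to_K]
    rfl
  exact_mod_cast h2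

/-- Compressing the matrix `Z` by the column `(f k g(j))ⱼ` gives `∑ Zᵢⱼ f g(i) g(j)`. -/
theorem IsMatrixUnits.norm_sum_le (hf : IsMatrixUnits f) (g : Fin n ↪ ι)
    {Z : Matrix (Fin n) (Fin n) (E →L[ℂ] E)} (hZ : ∀ i j k l, Commute (Z i j) (f k l)) :
    ‖∑ i, ∑ j, Z i j * f (g i) (g j)‖ ≤ ‖matrixOp Z‖ := by
  rcases n.eq_zero_or_pos with rfl | hn
  · simp
  let k := g ⟨0, hn⟩
  let V : E → PiLp 2 (fun _ : Fin n => E) := fun ξ => WithLp.toLp 2 fun j => f k (g j) ξ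
  have hV : ∀ ξ, ‖V ξ‖ ≤ ‖ξ‖ := by
    intro ξ
    refine (sq_le_sq₀ (norm_nonneg _) (norm_nonneg _)).1 ?_
    rw [PiLp.norm_sq_eq_of_L2, ← hf.sum_norm_sq k ξ]
    calc ∑ j, ‖V ξ j‖ ^ 2 = ∑ l ∈ Finset.univ.map g, ‖f k l ξ‖ ^ 2 := by
          rw [Finset.sum_map]
      _ ≤ ∑ l, ‖f k l ξ‖ ^ 2 :=
          Finset.sum_le_sum_of_subset_of_nonneg (Finset.subset_univ _) fun _ _ _ => by positivity
  set z := ∑ i, ∑ j, Z i j * f (g i) (g j) with hz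
  have hinner : ∀ ξ η, inner ℂ η (z ξ) = inner ℂ (V η) (matrixOp Z (V ξ)) := by
    intro ξ η
    rw [PiLp.inner_apply, hz]
    simp only [sum_apply, inner_sum, matrixOp_apply]
    refine Finset.sum_congr rfl fun i _ => Finset.sum_congr rfl fun j _ => ?_
    have h1 : Z i j * f (g i) (g j) = Star.star (f k (g i)) * (Z i j * f k (g j)) := by
      rw [hf.star, ← mul_assoc, ← (hZ i j _ _).eq, mul_assoc, hf.mul, if_pos rfl]
    rw [h1]
    exact ContinuousLinearMap.adjoint_inner_right (f k (g i)) _ _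
  refine z.opNorm_le_bound (norm_nonneg _) fun ξ => ?_
  rcases eq_or_ne (z ξ) 0 with h0 | h0
  · rw [h0, norm_zero]; positivity
  refine le_of_mul_le_mul_left ?_ (norm_pos_iff.2 h0)
  have h1 : ‖z ξ‖ * ‖z ξ‖ = ‖inner ℂ (z ξ) (z ξ)‖ := by
    rw [inner_self_eq_norm_sq_to_K]; simp [sq]
  rw [h1, hinner]
  calc ‖inner ℂ (V (z ξ)) (matrixOp Z (V ξ))‖ ≤ ‖V (z ξ)‖ * ‖matrixOp Z (V ξ)‖ :=
        norm_inner_le_norm _ _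
    _ ≤ ‖z ξ‖ * (‖matrixOp Z‖ * ‖ξ‖) := by
        gcongr
        · exact hV _
        · exact ((matrixOp Z).le_opNorm _).trans (by gcongr; exact hV _)

/-- The rows `(f g(j) k)ⱼ`, for varying `k`, intertwine the matrix `Z` with `∑ Zᵢⱼ f g(i) g(j)`. -/
theorem IsMatrixUnits.norm_matrixOp_le (hf : IsMatrixUnits f) (g : Fin n ↪ ι)
    {Z : Matrix (Fin n) (Fin n) (E →L[ℂ] E)} (hZ : ∀ i j k l, Commute (Z i j) (f k l)) :
    ‖matrixOp Z‖ ≤ ‖∑ i, ∑ j, Z i j * f (g i) (g j)‖ := by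
  set z := ∑ i, ∑ j, Z i j * f (g i) (g j) with hz
  let W : ι → PiLp 2 (fun _ : Fin n => E) → E := fun k ζ => ∑ j, f (g j) k (ζ j)
  have hW : ∀ ζ, ∑ k, ‖W k ζ‖ ^ 2 = ‖ζ‖ ^ 2 := by
    intro ζ
    have h1 : ∀ k, (‖W k ζ‖ ^ 2 : ℂ) = ∑ j, inner ℂ (ζ j) (f k k (ζ j)) := fun k => by
      have h2 := inner_self_eq_norm_sq_to_K (𝕜 := ℂ) (W k ζ)
      simp only [W, inner_sum, sum_inner, hf.inner_apply_apply, g.apply_eq_iff_eq,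
        Finset.sum_ite_eq', Finset.mem_univ, if_true] at h2
      exact h2.symm
    have h2 : ((∑ k, ‖W k ζ‖ ^ 2 : ℝ) : ℂ) = ((‖ζ‖ ^ 2 : ℝ) : ℂ) := by
      push_cast
      simp only [h1]
      rw [Finset.sum_comm]
      simp only [← inner_sum, ← sum_apply, hf.sum, one_apply_eq_self]
      rw [← PiLp.inner_apply, inner_self_eq_norm_sq_to_K]
      rfl
    exact_mod_cast h2
  have hzW : ∀ k ζ, z (W k ζ) = W k (matrixOp Z ζ) := by
    intro k ζ
    have h1 : ∀ i j j', (Z i j) ((f (g i) (g j)) (f (g j') k (ζ j'))) =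
        if j = j' then f (g i) k (Z i j (ζ j')) else 0 := by
      intro i j j'
      have h2 : Z i j * (f (g i) (g j) * f (g j') k) = if j = j' then f (g i) k * Z i j else 0 := by
        rw [hf.mul]
        simp only [g.apply_eq_iff_eq]
        split_ifs
        · exact hZ i j _ _
        · exact mul_zero _
      have h3 := congrArg (fun T : E →L[ℂ] E => T (ζ j')) h2
      split_ifs with hj
      · simpa [hj] using h3
      · simpa [hj] using h3
    simp only [hz, W, sum_apply, mul_apply_eq_comp, map_sum, h1, Finset.sum_ite_eq',
      Finset.mem_univ, if_true, matrixOp_apply]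
    exact Finset.sum_comm
  refine (matrixOp Z).opNorm_le_bound (norm_nonneg _) fun ζ => ?_
  refine (sq_le_sq₀ (norm_nonneg _) (by positivity)).1 ?_
  rw [← hW, mul_pow, ← hW ζ, Finset.mul_sum]
  refine Finset.sum_le_sum fun k _ => ?_
  rw [← hzW, ← mul_pow]
  gcongr
  exact z.le_opNorm _

end MatrixUnitNorm

/-! ### The ultraweak topology -/

section Ultraweak

variable {E : Type*} [NormedAddCommGroup E] [InnerProductSpace ℂ E]

open Filter Topology

theorem continuous_inner_ultraweak (ξ η : E) :
    @Continuous _ _ (ultraweak E) _ fun b : E →L[ℂ] E => inner ℂ ξ (b η) := by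
  have h := continuous_iInf_dom (t₁ := fun p : lp (fun _ : ℕ => E) 2 × lp (fun _ : ℕ => E) 2 =>
    TopologicalSpace.induced (fun x : E →L[ℂ] E => ∑' k, inner ℂ (p.1 k) (x (p.2 k))) inferInstance)
    (i := (lp.single 2 0 ξ, lp.single 2 0 η)) continuous_induced_dom
  convert h using 2 with b
  rw [tsum_eq_single 0]
  · simp
  · intro k hk
    simp [hk]

theorem commute_of_mem_ultraweak_closure {s : Set (E →L[ℂ] E)} {z : E →L[ℂ] E}
    [CompleteSpace E] (hz : ∀ b ∈ s, Commute b z) {b : E →L[ℂ] E}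
    (hb : b ∈ @closure _ (ultraweak E) s) : Commute b z := by
  have h1 : ∀ ξ η, inner ℂ ξ ((b * z) η) = inner ℂ ξ ((z * b) η) := by
    intro ξ η
    have e : ∀ b : E →L[ℂ] E, inner ℂ ξ ((z * b) η) = inner ℂ ((star z) ξ) (b η) := fun b =>
      (ContinuousLinearMap.adjoint_inner_left z _ _).symm
    let D : (E →L[ℂ] E) → ℂ := fun b => inner ℂ ξ (b (z η)) - inner ℂ ((star z) ξ) (b η)
    have hD : @Continuous _ _ (ultraweak E) _ D :=
      letI := ultraweak E
      Continuous.sub (continuous_inner_ultraweak ξ (z η))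
        (continuous_inner_ultraweak ((star z) ξ) η)
    have hcl : IsClosed[ultraweak E] (D ⁻¹' {0}) :=
      @IsClosed.preimage _ _ (ultraweak E) _ _ hD _ isClosed_singleton
    have hs : s ⊆ D ⁻¹' {0} := fun c hc => by
      have h3 : inner ℂ ξ (c (z η)) = inner ℂ ((star z) ξ) (c η) := by
        rw [← e, ← (hz c hc).eq]; rfl
      exact sub_eq_zero.2 h3
    have h2 : inner ℂ ξ (b (z η)) = inner ℂ ((star z) ξ) (b η) :=
      sub_eq_zero.1 (@closure_minimal _ (ultraweak E) _ _ hs hcl b hb)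
    rw [e]
    exact h2
  ext η
  exact ext_inner_left ℂ fun ξ => h1 ξ η

/-- Bounded strong convergence implies ultraweak convergence. -/
theorem tendsto_ultraweak {α : Type*} {l : Filter α} {T : α → E →L[ℂ] E} {T₀ : E →L[ℂ] E} {C : ℝ}
    (hC : ∀ᶠ a in l, ‖T a‖ ≤ C) (hT : ∀ ξ, Tendsto (fun a => T a ξ) l (𝓝 (T₀ ξ))) :
    Tendsto T l (@nhds _ (ultraweak E) T₀) := by
  rw [nhds_iInf, tendsto_iInf]
  rintro ⟨p, q⟩
  rw [nhds_induced, tendsto_comap_iff]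
  have hp := lp.memℓp p
  have hq := lp.memℓp q
  have hsum : Summable fun k => C * (‖p k‖ * ‖q k‖) := by
    refine Summable.mul_left _ ?_
    have h1 : Summable fun k => ‖p k‖ ^ (2 : ℝ) := by simpa using hp.summable (by simp)
    have h2 : Summable fun k => ‖q k‖ ^ (2 : ℝ) := by simpa using hq.summable (by simp)
    exact Real.summable_mul_of_Lp_Lq_of_nonneg (p := 2) (q := 2)
      ⟨by norm_num, by norm_num, by norm_num⟩
      (fun _ => norm_nonneg _) (fun _ => norm_nonneg _) h1 h2
  refine tendsto_tsum_of_dominated_convergence hsum (fun k => ?_) ?_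
  · exact tendsto_const_nhds.inner (hT (q k))
  · filter_upwards [hC] with a ha k
    calc ‖inner ℂ (p k) (T a (q k))‖ ≤ ‖p k‖ * ‖T a (q k)‖ := norm_inner_le_norm _ _
      _ ≤ ‖p k‖ * (C * ‖q k‖) := by gcongr; exact (T a).le_of_opNorm_le ha _
      _ = C * (‖p k‖ * ‖q k‖) := by ring

end Ultraweak

/-! ### Tensor products of operators -/

section Tensor

variable {H : Type*} [NormedAddCommGroup H] [InnerProductSpace ℂ H]
  {K : Type*} [NormedAddCommGroup K] [InnerProductSpace ℂ K]

/-- The simple tensor `ξ ⊗ η` as an element of the Hilbert space tensor product. -/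
def simpleTensor (ξ : H) (η : K) : HilbertTensor H K := ((ξ ⊗ₜ[ℂ] η : H ⊗[ℂ] K) : HilbertTensor H K)

theorem inner_simpleTensor (ξ ξ' : H) (η η' : K) :
    inner ℂ (simpleTensor ξ η) (simpleTensor ξ' η') = inner ℂ ξ ξ' * inner ℂ η η' := by
  rw [simpleTensor, simpleTensor, UniformSpace.Completion.inner_coe, TensorProduct.inner_tmul]

theorem tensorOp_simpleTensor (a : H →L[ℂ] H) (b : K →L[ℂ] K) (ξ : H) (η : K) :
    tensorOp a b (simpleTensor ξ η) = simpleTensor (a ξ) (b η) := by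
  simp [tensorOp, simpleTensor]

theorem ext_simpleTensor {F : Type*} [AddCommGroup F] [Module ℂ F] [TopologicalSpace F] [T2Space F]
    {S T : HilbertTensor H K →L[ℂ] F}
    (h : ∀ ξ η, S (simpleTensor ξ η) = T (simpleTensor ξ η)) : S = T := by
  ext ζ
  refine UniformSpace.Completion.induction_on ζ (isClosed_eq S.continuous T.continuous) fun t => ?_
  induction t using TensorProduct.induction_on with
  | zero => rw [UniformSpace.Completion.coe_zero, map_zero, map_zero]
  | tmul ξ η => exact h ξ η
  | add x y hx hy => rw [UniformSpace.Completion.coe_add, map_add, map_add, hx, hy]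

/-- Operators on the Hilbert space tensor product are determined by their matrix coefficients at
simple tensors. -/
theorem ext_inner_simpleTensor {S T : HilbertTensor H K →L[ℂ] HilbertTensor H K}
    (h : ∀ ξ η ξ' η', inner ℂ (simpleTensor ξ' η') (S (simpleTensor ξ η)) =
      inner ℂ (simpleTensor ξ' η') (T (simpleTensor ξ η))) : S = T := by
  refine ext_simpleTensor fun ξ η => ext_inner_left ℂ fun ζ => ?_
  have h1 : innerSL ℂ (S (simpleTensor ξ η)) = innerSL ℂ (T (simpleTensor ξ η)) := by
    refine ext_simpleTensor fun ξ' η' => ?_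
    rw [innerSL_apply_apply, innerSL_apply_apply, ← inner_conj_symm, h, inner_conj_symm]
  have h2 := congrArg (fun f : HilbertTensor H K →L[ℂ] ℂ => f ζ) h1
  simp only [innerSL_apply_apply] at h2
  rw [← inner_conj_symm, h2, inner_conj_symm]

theorem tensorOp_mul (a a' : H →L[ℂ] H) (b b' : K →L[ℂ] K) :
    tensorOp (a * a') (b * b') = tensorOp a b * tensorOp a' b' :=
  ext_simpleTensor fun ξ η => by
    rw [mul_apply_eq_comp]
    simp only [tensorOp_simpleTensor]; rfl

theorem tensorOp_one : tensorOp (1 : H →L[ℂ] H) (1 : K →L[ℂ] K) = 1 :=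
  ext_simpleTensor fun ξ η => by simp only [tensorOp_simpleTensor, one_apply_eq_self]

theorem tensorOp_zero_right (a : H →L[ℂ] H) : tensorOp a (0 : K →L[ℂ] K) = 0 :=
  ext_simpleTensor fun ξ η => by
    rw [tensorOp_simpleTensor]
    simp [simpleTensor]

theorem tensorOp_add_right (a : H →L[ℂ] H) (b b' : K →L[ℂ] K) :
    tensorOp a (b + b') = tensorOp a b + tensorOp a b' :=
  ext_simpleTensor fun ξ η => by
    rw [add_apply, tensorOp_simpleTensor, tensorOp_simpleTensor, tensorOp_simpleTensor, add_apply]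
    simp only [simpleTensor, TensorProduct.tmul_add, UniformSpace.Completion.coe_add]

theorem star_tensorOp [CompleteSpace H] [CompleteSpace K] (a : H →L[ℂ] H) (b : K →L[ℂ] K) :
    star (tensorOp a b) = tensorOp (star a) (star b) := by
  refine ext_inner_simpleTensor fun ξ η ξ' η' => ?_
  have h1 : inner ℂ (simpleTensor ξ' η') ((star (tensorOp a b)) (simpleTensor ξ η)) =
      inner ℂ (tensorOp a b (simpleTensor ξ' η')) (simpleTensor ξ η) :=
    ContinuousLinearMap.adjoint_inner_right _ _ _
  have h2 : inner ℂ ξ' ((star a) ξ) = inner ℂ (a ξ') ξ :=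
    ContinuousLinearMap.adjoint_inner_right _ _ _
  have h3 : inner ℂ η' ((star b) η) = inner ℂ (b η') η :=
    ContinuousLinearMap.adjoint_inner_right _ _ _
  rw [h1, tensorOp_simpleTensor, tensorOp_simpleTensor, inner_simpleTensor, inner_simpleTensor, h2,
    h3]

/-- The operator `η ↦ ξ ⊗ η`. -/
def tensorLeft (ξ : H) : K →L[ℂ] HilbertTensor H K :=
  UniformSpace.Completion.toComplL ∘L TensorProduct.mkL ℂ H K ξ

/-- If `z` commutes with `1 ⊗ s`, then it commutes with `1 ⊗ b` for every `b` in the ultraweak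
closure of `s`: the slices `⟪ξ', z ξ⟫` of `z` commute with `s`, hence with its closure. -/
theorem commute_one_tensorOp_of_mem_closure [CompleteSpace H] [CompleteSpace K]
    {s : Set (K →L[ℂ] K)} {z : HilbertTensor H K →L[ℂ] HilbertTensor H K}
    (hz : ∀ b ∈ s, Commute (tensorOp 1 b) z) {b : K →L[ℂ] K}
    (hb : b ∈ @closure _ (ultraweak K) s) : Commute (tensorOp 1 b) z := by
  have hleft : ∀ (c : K →L[ℂ] K) (ξ : H), tensorOp 1 c ∘L tensorLeft ξ = tensorLeft ξ ∘L c :=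
    fun c ξ => by
      ext η
      exact tensorOp_simpleTensor 1 c ξ η
  let slice : H → H → K →L[ℂ] K := fun ξ' ξ =>
    ContinuousLinearMap.adjoint (tensorLeft ξ') ∘L z ∘L tensorLeft ξ
  have hslice : ∀ ξ' ξ η' η, inner ℂ η' (slice ξ' ξ η) =
      inner ℂ (simpleTensor ξ' η') (z (simpleTensor ξ η)) := fun ξ' ξ η' η =>
    ContinuousLinearMap.adjoint_inner_right (tensorLeft ξ') η' (z (tensorLeft ξ η))
  have hstar : ∀ (c : K →L[ℂ] K) (ξ : H) (η : K) (ζ : HilbertTensor H K),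
      inner ℂ (simpleTensor ξ η) (tensorOp 1 c ζ) = inner ℂ (simpleTensor ξ ((star c) η)) ζ := by
    intro c ξ η ζ
    have h1 : inner ℂ ((star (tensorOp 1 c)) (simpleTensor ξ η)) ζ =
      inner ℂ (simpleTensor ξ η) (tensorOp 1 c ζ) := ContinuousLinearMap.adjoint_inner_left _ _ _
    rw [← h1, star_tensorOp, tensorOp_simpleTensor, star_one, one_apply_eq_self]
  -- both sides of the commutation relation, in terms of slices
  have e1 : ∀ (c : K →L[ℂ] K) ξ' ξ η' η, inner ℂ (simpleTensor ξ' η')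
      ((tensorOp 1 c * z : HilbertTensor H K →L[ℂ] HilbertTensor H K) (simpleTensor ξ η)) =
        inner ℂ η' ((c * slice ξ' ξ) η) := by
    intro c ξ' ξ η' η
    have h1 : inner ℂ ((star c) η') (slice ξ' ξ η) = inner ℂ η' (c (slice ξ' ξ η)) :=
      ContinuousLinearMap.adjoint_inner_left _ _ _
    rw [mul_apply_eq_comp, hstar, mul_apply_eq_comp, ← h1, hslice]
  have e2 : ∀ (c : K →L[ℂ] K) ξ' ξ η' η, inner ℂ (simpleTensor ξ' η')
      ((z * tensorOp 1 c : HilbertTensor H K →L[ℂ] HilbertTensor H K) (simpleTensor ξ η)) =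
        inner ℂ η' ((slice ξ' ξ * c) η) := by
    intro c ξ' ξ η' η
    rw [mul_apply_eq_comp, mul_apply_eq_comp, hslice, tensorOp_simpleTensor, one_apply_eq_self]
  have hcomm : ∀ ξ' ξ, Commute b (slice ξ' ξ) := fun ξ' ξ =>
    commute_of_mem_ultraweak_closure (fun c hc => by
      ext η
      refine ext_inner_left ℂ fun η' => ?_
      rw [← e1, (hz c hc).eq, e2]) hb
  exact ext_inner_simpleTensor fun ξ η ξ' η' => by rw [e1, (hcomm ξ' ξ).eq, e2]

end Tensor

/-! ### Amplifications on relative commutants of matrix units -/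

section FiniteLevel

variable {E : Type*} [NormedAddCommGroup E] [InnerProductSpace ℂ E] [CompleteSpace E]
  {N : VonNeumannAlgebra E}
  {φ : N.toStarSubalgebra →ₗ[ℂ] N.toStarSubalgebra →ₗ[ℂ] N.toStarSubalgebra}

/-- If `P` contains matrix units of size at least `n`, then `φₙ` is bounded by the bound of `φ` on
matrices over the relative commutant of the matrix units: writing `x = ∑ Xᵢⱼ fᵢⱼ` and
`y = ∑ Yᵢⱼ fᵢⱼ`, multimodularity gives `φ(x, y) = ∑ φₙ(X, Y)ᵢⱼ fᵢⱼ`, and these sums have the norms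
of the matrices of their coefficients. -/
theorem matrixNorm_amplification_le_of_matrixUnits {ι : Type*} [Fintype ι] [DecidableEq ι]
    {P : VonNeumannAlgebra E} (hPN : P ≤ N) (hφm : IsMultimodular φ P) {C : ℝ} (hC0 : 0 ≤ C)
    (hC : ∀ x y, ‖(φ x y : E →L[ℂ] E)‖ ≤ C * ‖(x : E →L[ℂ] E)‖ * ‖(y : E →L[ℂ] E)‖)
    {f : ι → ι → E →L[ℂ] E} (hf : IsMatrixUnits f) (hfP : ∀ i j, f i j ∈ P) {n : ℕ}
    (g : Fin n ↪ ι) {X Y : Matrix (Fin n) (Fin n) N.toStarSubalgebra}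
    (hX : ∀ i j k l, Commute (X i j : E →L[ℂ] E) (f k l))
    (hY : ∀ i j k l, Commute (Y i j : E →L[ℂ] E) (f k l)) :
    matrixNorm N (amplification φ n X Y) ≤ C * matrixNorm N X * matrixNorm N Y := by
  let r : ι → ι → N.toStarSubalgebra := fun i j => ⟨f i j, hPN (hfP i j)⟩
  have hrr : ∀ i j k l, r i j * r k l = if j = k then r i l else 0 := fun i j k l => by
    refine Subtype.ext ?_
    have h := hf.mul i j k l
    split_ifs at h ⊢ <;> exact h
  have hrX : ∀ i j k l, X i j * r k l = r k l * X i j := fun i j k l =>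
    Subtype.ext (hX i j k l).eq
  have hrY : ∀ i j k l, Y i j * r k l = r k l * Y i j := fun i j k l =>
    Subtype.ext (hY i j k l).eq
  have hφr : ∀ i j k l p q, φ (X i j) (Y k l) * r p q = r p q * φ (X i j) (Y k l) := by
    intro i j k l p q
    have h1 := hφm (r p q) (hfP p q)
    rw [← (h1 (X i j) (Y k l)).2.2, hrY, ← (h1 (X i j) (Y k l)).2.1, hrX, (h1 _ _).1]
  have hcomm : ∀ i j k l, Commute (amplification φ n X Y i j : E →L[ℂ] E) (f k l) := by
    intro i j k l
    have h1 : amplification φ n X Y i j * r k l = r k l * amplification φ n X Y i j := by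
      simp only [amplification, Matrix.of_apply, Finset.sum_mul, Finset.mul_sum, hφr]
    exact congrArg Subtype.val h1
  let σ : Matrix (Fin n) (Fin n) N.toStarSubalgebra → N.toStarSubalgebra := fun Z =>
    ∑ i, ∑ j, Z i j * r (g i) (g j)
  have hσ : ∀ Z, (σ Z : E →L[ℂ] E) = ∑ i, ∑ j, (Z i j : E →L[ℂ] E) * f (g i) (g j) := fun Z => by
    simp only [σ, AddSubmonoidClass.coe_finsetSum, MulMemClass.coe_mul, r]
  have hφσ : φ (σ X) (σ Y) = σ (amplification φ n X Y) := by
    have h1 : ∀ i j k l, φ (X i j * r (g i) (g j)) (Y k l * r (g k) (g l)) =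
        if j = k then φ (X i j) (Y k l) * r (g i) (g l) else 0 := by
      intro i j k l
      rw [(hφm (r (g i) (g j)) (hfP _ _) _ _).2.1, ← mul_assoc, ← hrY, mul_assoc, hrr]
      simp only [g.apply_eq_iff_eq]
      split_ifs
      · exact (hφm (r (g i) (g l)) (hfP _ _) _ _).2.2
      · rw [mul_zero, map_zero]
    simp only [σ, map_sum, LinearMap.sum_apply, h1, amplification, Matrix.of_apply, Finset.sum_mul,
      Finset.sum_ite_eq', Finset.mem_univ, if_true]
    exact (Finset.sum_congr rfl fun k _ => Finset.sum_comm).trans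
      (Finset.sum_comm.trans (Finset.sum_congr rfl fun i _ => Finset.sum_comm))
  have h1 : matrixNorm N (amplification φ n X Y) ≤ ‖(σ (amplification φ n X Y) : E →L[ℂ] E)‖ := by
    rw [hσ]
    exact hf.norm_matrixOp_le g hcomm
  have h2 : ‖(σ X : E →L[ℂ] E)‖ ≤ matrixNorm N X := by
    rw [hσ]
    exact hf.norm_sum_le g hX
  have h3 : ‖(σ Y : E →L[ℂ] E)‖ ≤ matrixNorm N Y := by
    rw [hσ]
    exact hf.norm_sum_le g hY
  rw [← hφσ] at h1
  have hX0 : 0 ≤ matrixNorm N X := norm_nonneg _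
  exact h1.trans ((hC _ _).trans (by gcongr))

end FiniteLevel

/-! ### Passage to the limit -/

section Limit

variable {E : Type*} [NormedAddCommGroup E] [InnerProductSpace ℂ E] [CompleteSpace E]
  {N : VonNeumannAlgebra E}

open Filter Topology

theorem norm_entry_le {n : ℕ}
    (Z : PiLp 2 (fun _ : Fin n => E) →L[ℂ] PiLp 2 (fun _ : Fin n => E)) (i j : Fin n) :
    ‖entry Z i j‖ ≤ ‖Z‖ := by
  refine ContinuousLinearMap.opNorm_le_bound _ (norm_nonneg _) fun ξ => ?_
  rw [entry_apply]
  refine (PiLp.norm_apply_le _ _).trans ((Z.le_opNorm _).trans_eq ?_)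
  exact congrArg _ (PiLp.norm_single 2 (fun _ : Fin n => E) j ξ)

/-- Kaplansky's density theorem for matrices over a von Neumann algebra. -/
theorem exists_filter_matrix_tendsto {D : StarSubalgebra ℂ (E →L[ℂ] E)} (hDN : ∀ x ∈ D, x ∈ N)
    (hD : ∀ T ∈ N, InBicommutant D T) {n : ℕ} (X : Matrix (Fin n) (Fin n) N.toStarSubalgebra) :
    ∃ l : Filter (Matrix (Fin n) (Fin n) N.toStarSubalgebra), l.NeBot ∧
      (∀ᶠ Z in l, (∀ i j, (Z i j : E →L[ℂ] E) ∈ D) ∧ matrixNorm N Z ≤ 2 * matrixNorm N X) ∧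
      ∀ i j, Tendsto (fun Z => (Z i j : E →L[ℂ] E)) l (@nhds _ (ultraweak E) (X i j)) := by
  obtain ⟨l, hl, hlD, hlim⟩ := exists_bounded_strong_approx
    (InBicommutant.matrixOp (X := X.map fun x => (x : E →L[ℂ] E)) fun i j => hD _ (X i j).2)
  let m : Matrix (Fin n) (Fin n) N.toStarSubalgebra →
      (PiLp 2 (fun _ : Fin n => E) →L[ℂ] PiLp 2 (fun _ : Fin n => E)) :=
    fun Z => matrixOp (Z.map fun x => (x : E →L[ℂ] E))
  have hm : ∀ Z i j, entry (m Z) i j = Z i j := fun Z i j => by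
    simp only [m, entry_matrixOp, Matrix.map_apply]
  have hev : ∀ᶠ Z in comap m l,
      (∀ i j, (Z i j : E →L[ℂ] E) ∈ D) ∧ matrixNorm N Z ≤ 2 * matrixNorm N X := by
    filter_upwards [tendsto_comap.eventually hlD] with Z hZ
    refine ⟨fun i j => ?_, hZ.2⟩
    rw [← hm]
    exact hZ.1 i j
  refine ⟨comap m l, hl.comap_of_range_mem ?_, hev, fun i j => ?_⟩
  · filter_upwards [hlD] with Z hZ
    refine ⟨Matrix.of fun i j => ⟨entry Z i j, hDN _ (hZ.1 i j)⟩, ?_⟩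
    exact matrixOp_entry Z
  · refine tendsto_ultraweak (C := 2 * matrixNorm N X) ?_ fun ξ => ?_
    · filter_upwards [hev] with Z hZ
      rw [← hm]
      exact (norm_entry_le _ _ _).trans hZ.2
    · have h1 := (hlim (WithLp.toLp 2 (Pi.single j ξ))).comp (tendsto_comap (f := m))
      have h2 := (((PiLp.continuous_apply 2 (fun _ : Fin n => E) i).tendsto _).comp h1)
      convert h2 using 2 with Z
      · rw [← hm]; rfl
      · exact congrArg (fun T : E →L[ℂ] E => T ξ) (hm X i j).symm

/-- Normal maps carry ultraweak limits to weak limits. -/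
theorem IsNormal.tendsto_inner {f : N.toStarSubalgebra → N.toStarSubalgebra} (hf : IsNormal N f)
    {α : Type*} {l : Filter α} {T : α → N.toStarSubalgebra} {T₀ : N.toStarSubalgebra}
    (hT : Tendsto (fun a => (T a : E →L[ℂ] E)) l (@nhds _ (ultraweak E) T₀)) (ξ η : E) :
    Tendsto (fun a => inner ℂ ξ ((f (T a) : E →L[ℂ] E) η)) l
      (𝓝 (inner ℂ ξ ((f T₀ : E →L[ℂ] E) η))) := by
  let _ : TopologicalSpace N.toStarSubalgebra :=
    TopologicalSpace.induced Subtype.val (ultraweak E)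
  have h1 : Tendsto T l (𝓝 T₀) := by
    rw [@nhds_induced _ _ (ultraweak E), tendsto_comap_iff]
    exact hT
  have h2 : Continuous fun x : N.toStarSubalgebra => inner ℂ ξ ((x : E →L[ℂ] E) η) :=
    @Continuous.comp _ _ _ _ (ultraweak E) _ _ _ (continuous_inner_ultraweak ξ η)
      (@continuous_induced_dom _ _ _ (ultraweak E))
  exact ((h2.comp hf).tendsto T₀).comp h1

/-- The norm of `Mₙ(N)` is lower semicontinuous for entrywise weak convergence. -/
theorem matrixNorm_le_of_tendsto {n : ℕ} {α : Type*} {l : Filter α} [l.NeBot]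
    {Z : α → Matrix (Fin n) (Fin n) N.toStarSubalgebra}
    {Z₀ : Matrix (Fin n) (Fin n) N.toStarSubalgebra} {C : ℝ} (hC0 : 0 ≤ C)
    (hC : ∀ᶠ a in l, matrixNorm N (Z a) ≤ C)
    (hZ : ∀ i j ξ η, Tendsto (fun a => inner ℂ ξ ((Z a i j : E →L[ℂ] E) η)) l
      (𝓝 (inner ℂ ξ ((Z₀ i j : E →L[ℂ] E) η)))) : matrixNorm N Z₀ ≤ C := by
  have hinner : ∀ (W : Matrix (Fin n) (Fin n) N.toStarSubalgebra)
      (ζ ω : PiLp 2 (fun _ : Fin n => E)), inner ℂ ζ (matrixOp (W.map fun x => (x : E →L[ℂ] E)) ω) =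
        ∑ i, ∑ j, inner ℂ (ζ i) ((W i j : E →L[ℂ] E) (ω j)) := by
    intro W ζ ω
    rw [PiLp.inner_apply]
    simp only [matrixOp_apply, inner_sum, Matrix.map_apply]
  have hlim : ∀ ζ ω : PiLp 2 (fun _ : Fin n => E),
      ‖inner ℂ ζ (matrixOp (Z₀.map fun x => (x : E →L[ℂ] E)) ω)‖ ≤ C * ‖ζ‖ * ‖ω‖ := by
    intro ζ ω
    have h1 : Tendsto (fun a => ‖inner ℂ ζ (matrixOp ((Z a).map fun x => (x : E →L[ℂ] E)) ω)‖) l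
        (𝓝 ‖inner ℂ ζ (matrixOp (Z₀.map fun x => (x : E →L[ℂ] E)) ω)‖) := by
      simp only [hinner]
      exact (tendsto_finsetSum _ fun i _ => tendsto_finsetSum _ fun j _ => hZ i j _ _).norm
    refine le_of_tendsto h1 ?_
    filter_upwards [hC] with a ha
    calc ‖inner ℂ ζ (matrixOp ((Z a).map fun x => (x : E →L[ℂ] E)) ω)‖
        ≤ ‖ζ‖ * ‖matrixOp ((Z a).map fun x => (x : E →L[ℂ] E)) ω‖ := norm_inner_le_norm _ _
      _ ≤ ‖ζ‖ * (C * ‖ω‖) := by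
          gcongr
          exact ContinuousLinearMap.le_of_opNorm_le _ ha _
      _ = C * ‖ζ‖ * ‖ω‖ := by ring
  refine ContinuousLinearMap.opNorm_le_of_re_inner_le hC0 fun ω ζ hω hζ => ?_
  rw [← inner_conj_symm, RCLike.conj_re]
  refine (RCLike.re_le_norm _).trans ((hlim ζ ω).trans_eq ?_)
  rw [hω, hζ, mul_one, mul_one]

/-- A bound for `φₙ` on a dense `*`-subalgebra extends, up to a factor `4`, by separate
normality. -/
theorem matrixNorm_amplification_le_of_dense
    {φ : N.toStarSubalgebra →ₗ[ℂ] N.toStarSubalgebra →ₗ[ℂ] N.toStarSubalgebra}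
    (hφn : IsSeparatelyNormal φ) {D : StarSubalgebra ℂ (E →L[ℂ] E)} (hDN : ∀ x ∈ D, x ∈ N)
    (hD : ∀ T ∈ N, InBicommutant D T) {C : ℝ} (hC0 : 0 ≤ C) {n : ℕ}
    (hC : ∀ X Y : Matrix (Fin n) (Fin n) N.toStarSubalgebra, (∀ i j, (X i j : E →L[ℂ] E) ∈ D) →
      (∀ i j, (Y i j : E →L[ℂ] E) ∈ D) →
        matrixNorm N (amplification φ n X Y) ≤ C * matrixNorm N X * matrixNorm N Y)
    (X Y : Matrix (Fin n) (Fin n) N.toStarSubalgebra) :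
    matrixNorm N (amplification φ n X Y) ≤ 4 * C * matrixNorm N X * matrixNorm N Y := by
  have hpos : ∀ Z : Matrix (Fin n) (Fin n) N.toStarSubalgebra, 0 ≤ matrixNorm N Z := fun Z =>
    norm_nonneg _
  have hamp : ∀ (X Y : Matrix (Fin n) (Fin n) N.toStarSubalgebra) i j ξ η,
      inner ℂ ξ ((amplification φ n X Y i j : E →L[ℂ] E) η) =
        ∑ k, inner ℂ ξ ((φ (X i k) (Y k j) : E →L[ℂ] E) η) := by
    intro X Y i j ξ η
    simp only [amplification, Matrix.of_apply, AddSubmonoidClass.coe_finsetSum, sum_apply,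
      inner_sum]
  have hX : ∀ X Y : Matrix (Fin n) (Fin n) N.toStarSubalgebra, (∀ i j, (Y i j : E →L[ℂ] E) ∈ D) →
      matrixNorm N (amplification φ n X Y) ≤ 2 * C * matrixNorm N X * matrixNorm N Y := by
    intro X Y hY
    obtain ⟨l, hl, hlD, hlim⟩ := exists_filter_matrix_tendsto hDN hD X
    refine matrixNorm_le_of_tendsto (l := l) (Z := fun Z => amplification φ n Z Y)
      (by have := hpos X; have := hpos Y; positivity) ?_ fun i j ξ η => ?_
    · filter_upwards [hlD] with Z hZ
      calc matrixNorm N (amplification φ n Z Y) ≤ C * matrixNorm N Z * matrixNorm N Y :=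
            hC Z Y hZ.1 hY
        _ ≤ C * (2 * matrixNorm N X) * matrixNorm N Y := by
            have := hpos Y
            gcongr
            exact hZ.2
        _ = 2 * C * matrixNorm N X * matrixNorm N Y := by ring
    · simp only [hamp]
      exact tendsto_finsetSum _ fun k _ => (hφn.1 (Y k j)).tendsto_inner (hlim i k) ξ η
  obtain ⟨l, hl, hlD, hlim⟩ := exists_filter_matrix_tendsto hDN hD Y
  refine matrixNorm_le_of_tendsto (l := l) (Z := fun Z => amplification φ n X Z)
    (by have := hpos X; have := hpos Y; positivity) ?_ fun i j ξ η => ?_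
  · filter_upwards [hlD] with Z hZ
    calc matrixNorm N (amplification φ n X Z) ≤ 2 * C * matrixNorm N X * matrixNorm N Z :=
          hX X Z hZ.1
      _ ≤ 2 * C * matrixNorm N X * (2 * matrixNorm N Y) := by
          have := hpos X
          gcongr
          exact hZ.2
      _ = 4 * C * matrixNorm N X * matrixNorm N Y := by ring
  · simp only [hamp]
    exact tendsto_finsetSum _ fun k _ => (hφn.2 (X i k)).tendsto_inner (hlim k j) ξ η

end Limit

/-! ### Complete boundedness on the tensor product algebra -/

section TensorAlgebra

variable {H : Type*} [NormedAddCommGroup H] [InnerProductSpace ℂ H] [CompleteSpace H]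
  {K : Type*} [NormedAddCommGroup K] [InnerProductSpace ℂ K] [CompleteSpace K]

theorem tensorOp_mem_vnTensor {M : VonNeumannAlgebra H} {S : VonNeumannAlgebra K}
    {a : H →L[ℂ] H} {b : K →L[ℂ] K} (ha : a ∈ M) (hb : b ∈ S) : tensorOp a b ∈ vnTensor M S := by
  rw [vnTensor, ← SetLike.mem_coe, coe_generated]
  exact Set.subset_centralizer_centralizer (Or.inl ⟨a, ha, b, hb, rfl⟩)

/-- An operator commuting with all `a ⊗ b` commutes with the tensor product algebra. -/
theorem commute_of_mem_vnTensor {M : VonNeumannAlgebra H} {S : VonNeumannAlgebra K}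
    {z : HilbertTensor H K →L[ℂ] HilbertTensor H K}
    (hz : ∀ a ∈ M, ∀ b ∈ S, Commute (tensorOp a b) z)
    {T : HilbertTensor H K →L[ℂ] HilbertTensor H K} (hT : T ∈ vnTensor M S) : Commute T z := by
  rw [vnTensor, ← SetLike.mem_coe, coe_generated] at hT
  refine (hT z ?_).symm
  rintro x (⟨a, ha, b, hb, rfl⟩ | hx)
  · exact hz a ha b hb
  · obtain ⟨a, ha, b, hb, hx⟩ := hx
    rw [← star_star x, hx, star_tensorOp]
    exact hz _ (star_mem ha) _ (star_mem hb)

theorem IsMatrixUnits.tensorOp_one {ι : Type*} [Fintype ι] [DecidableEq ι]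
    {f : ι → ι → K →L[ℂ] K} (hf : IsMatrixUnits f) :
    IsMatrixUnits fun i j => tensorOp (1 : H →L[ℂ] H) (f i j) := by
  refine ⟨fun i j k l => ?_, fun i j => ?_, ?_⟩
  · rw [← tensorOp_mul, hf.mul, one_mul]
    split_ifs
    · rfl
    · exact tensorOp_zero_right _
  · rw [star_tensorOp, hf.star, star_one]
  · have h : ∀ s : Finset ι, ∑ i ∈ s, tensorOp (1 : H →L[ℂ] H) (f i i) =
        tensorOp 1 (∑ i ∈ s, f i i) := by
      intro s
      induction s using Finset.cons_induction with
      | empty => simp only [Finset.sum_empty, tensorOp_zero_right]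
      | cons i s hi ih => rw [Finset.sum_cons, Finset.sum_cons, tensorOp_add_right, ih]
    rw [h, hf.sum, VNTensor.tensorOp_one]

/-- The `*`-algebra of the operators in `M ⊗ S` commuting with `1 ⊗ (A' ∩ S)`. -/
def tensorLevel (M : VonNeumannAlgebra H) (S : VonNeumannAlgebra K)
    (A : StarSubalgebra ℂ (K →L[ℂ] K)) :
    StarSubalgebra ℂ (HilbertTensor H K →L[ℂ] HilbertTensor H K) :=
  (vnTensor M S).toStarSubalgebra ⊓
    StarSubalgebra.centralizer ℂ (tensorOp 1 '' (relCommutant A S : Set (K →L[ℂ] K)))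

theorem mem_tensorLevel {M : VonNeumannAlgebra H} {S : VonNeumannAlgebra K}
    {A : StarSubalgebra ℂ (K →L[ℂ] K)} {x : HilbertTensor H K →L[ℂ] HilbertTensor H K} :
    x ∈ tensorLevel M S A ↔
      x ∈ vnTensor M S ∧ ∀ f ∈ relCommutant A S, Commute x (tensorOp 1 f) := by
  refine and_congr_right fun _ => ?_
  change x ∈ StarSubalgebra.centralizer ℂ _ ↔ _
  rw [StarSubalgebra.mem_centralizer_iff]
  constructor
  · exact fun h f hf => (h _ ⟨f, hf, rfl⟩).1.symm
  · rintro h _ ⟨f, hf, rfl⟩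
    refine ⟨(h f hf).symm, ?_⟩
    rw [star_tensorOp, star_one]
    exact (h _ (star_mem hf)).symm

theorem tensorLevel_mono {M : VonNeumannAlgebra H} {S : VonNeumannAlgebra K} :
    Monotone (tensorLevel M S) := by
  intro A A' hA x hx
  rw [mem_tensorLevel] at hx ⊢
  refine ⟨hx.1, fun f hf => hx.2 f ?_⟩
  rw [mem_relCommutant] at hf ⊢
  exact ⟨hf.1, fun a ha => hf.2 a (hA ha)⟩

theorem tensorOp_one_right_mem_tensorLevel {M : VonNeumannAlgebra H} {S : VonNeumannAlgebra K}
    {A : StarSubalgebra ℂ (K →L[ℂ] K)} {a : H →L[ℂ] H} (ha : a ∈ M) :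
    tensorOp a 1 ∈ tensorLevel M S A := by
  refine mem_tensorLevel.2 ⟨tensorOp_mem_vnTensor ha (one_mem S), fun f _ => ?_⟩
  rw [Commute, SemiconjBy, ← tensorOp_mul, ← tensorOp_mul, mul_one, one_mul, mul_one, one_mul]

theorem tensorOp_one_left_mem_tensorLevel {M : VonNeumannAlgebra H} {S : VonNeumannAlgebra K}
    {A : StarSubalgebra ℂ (K →L[ℂ] K)} (hAS : ∀ x ∈ A, x ∈ S) {b : K →L[ℂ] K} (hb : b ∈ A) :
    tensorOp 1 b ∈ tensorLevel M S A := by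
  refine mem_tensorLevel.2 ⟨tensorOp_mem_vnTensor (one_mem M) (hAS b hb), fun f hf => ?_⟩
  rw [Commute, SemiconjBy, ← tensorOp_mul, ← tensorOp_mul, ((mem_relCommutant.1 hf).2 b hb).eq]

/-- If the algebras in `F` are ultraweakly dense in `S`, then the corresponding levels generate
`M ⊗ S`. -/
theorem inBicommutant_iSup_tensorLevel {M : VonNeumannAlgebra H} {S : VonNeumannAlgebra K}
    {F : Set (StarSubalgebra ℂ (K →L[ℂ] K))} (hF : F.Nonempty)
    (hcl : @closure _ (ultraweak K) (⋃ A ∈ F, (A : Set (K →L[ℂ] K))) = (S : Set (K →L[ℂ] K)))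
    (hFS : ∀ A ∈ F, ∀ x ∈ A, x ∈ S) {T : HilbertTensor H K →L[ℂ] HilbertTensor H K}
    (hT : T ∈ vnTensor M S) : InBicommutant (⨆ A : F, tensorLevel M S A.1) T := by
  intro z hz
  have hz' : ∀ A ∈ F, ∀ x ∈ tensorLevel M S A, Commute x z := fun A hA x hx =>
    hz x (le_iSup (fun A : F => tensorLevel M S A.1) ⟨A, hA⟩ hx)
  refine commute_of_mem_vnTensor (fun a ha b hb => ?_) hT
  have h1 : Commute (tensorOp a 1) z :=
    hz' _ hF.some_mem _ (tensorOp_one_right_mem_tensorLevel ha)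
  have h2 : Commute (tensorOp 1 b) z := by
    refine commute_one_tensorOp_of_mem_closure (s := ⋃ A ∈ F, (A : Set (K →L[ℂ] K))) ?_ ?_
    · intro c hc
      obtain ⟨A, hA, hcA⟩ := Set.mem_iUnion₂.1 hc
      exact hz' A hA _ (tensorOp_one_left_mem_tensorLevel (hFS A hA) hcA)
    · rw [hcl]; exact hb
  have h3 := h1.mul_left h2
  rwa [← tensorOp_mul, mul_one, one_mul] at h3

/-- The bound of `φₙ` on matrices over the relative commutant of `1 ⊗ (A' ∩ S)`, for a
finite-dimensional algebra `A`: the algebra `A' ∩ S` has no abelian projections, so it contains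
matrix units of every size `2ⁿ`. -/
theorem matrixNorm_amplification_le_of_mem_tensorLevel {M R : VonNeumannAlgebra H}
    {S : VonNeumannAlgebra K} (hS : NoAbelianProjection S) (hRM : R ≤ M)
    {φ : (vnTensor M S).toStarSubalgebra →ₗ[ℂ]
      (vnTensor M S).toStarSubalgebra →ₗ[ℂ] (vnTensor M S).toStarSubalgebra}
    (hφm : IsMultimodular φ (vnTensor R S)) {C : ℝ} (hC0 : 0 ≤ C)
    (hC : ∀ x y, ‖(φ x y : HilbertTensor H K →L[ℂ] HilbertTensor H K)‖ ≤
      C * ‖(x : HilbertTensor H K →L[ℂ] HilbertTensor H K)‖ *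
        ‖(y : HilbertTensor H K →L[ℂ] HilbertTensor H K)‖)
    {A : StarSubalgebra ℂ (K →L[ℂ] K)} [FiniteDimensional ℂ A] (hAS : ∀ x ∈ A, x ∈ S) {n : ℕ}
    {X Y : Matrix (Fin n) (Fin n) (vnTensor M S).toStarSubalgebra}
    (hX : ∀ i j, (X i j : HilbertTensor H K →L[ℂ] HilbertTensor H K) ∈ tensorLevel M S A)
    (hY : ∀ i j, (Y i j : HilbertTensor H K →L[ℂ] HilbertTensor H K) ∈ tensorLevel M S A) :
    matrixNorm _ (amplification φ n X Y) ≤ C * matrixNorm _ X * matrixNorm _ Y := by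
  obtain ⟨ι, _, _, f, hcard, hf, hfA⟩ := exists_matrixUnits n (hS.relCommutant hAS)
  obtain ⟨g⟩ : Nonempty (Fin n ↪ ι) := Function.Embedding.nonempty_of_card_le (by
    rw [Fintype.card_fin]; exact n.lt_two_pow_self.le.trans hcard)
  exact matrixNorm_amplification_le_of_matrixUnits (vnTensor_mono_left hRM S) hφm hC0 hC
    (hf.tensorOp_one (H := H))
    (fun i j => tensorOp_mem_vnTensor (one_mem R) (mem_relCommutant.1 (hfA i j)).1) g
    (fun i j k l => (mem_tensorLevel.1 (hX i j)).2 _ (hfA k l))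
    (fun i j k l => (mem_tensorLevel.1 (hY i j)).2 _ (hfA k l))

theorem mem_iSup_tensorLevel {M : VonNeumannAlgebra H} {S : VonNeumannAlgebra K}
    {F : Set (StarSubalgebra ℂ (K →L[ℂ] K))} [Nonempty F] (hdir : DirectedOn (· ≤ ·) F)
    {x : HilbertTensor H K →L[ℂ] HilbertTensor H K} :
    x ∈ (⨆ A : F, tensorLevel M S A.1) ↔ ∃ A : F, x ∈ tensorLevel M S A.1 := by
  have hdir' : Directed (· ≤ ·) fun A : F => tensorLevel M S A.1 := fun A B => by
    obtain ⟨A', hA', hA, hB⟩ := hdir A.1 A.2 B.1 B.2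
    exact ⟨⟨A', hA'⟩, tensorLevel_mono hA, tensorLevel_mono hB⟩
  rw [← SetLike.mem_coe, StarSubalgebra.coe_iSup_of_directed hdir', Set.mem_iUnion]
  rfl

/-- Finitely many elements of the union of the levels lie in a common level. -/
theorem exists_tensorLevel_of_mem_iSup {M : VonNeumannAlgebra H} {S : VonNeumannAlgebra K}
    {F : Set (StarSubalgebra ℂ (K →L[ℂ] K))} [Nonempty F] (hdir : DirectedOn (· ≤ ·) F)
    {κ : Type*} [Finite κ] {x : κ → HilbertTensor H K →L[ℂ] HilbertTensor H K}
    (hx : ∀ k, x k ∈ (⨆ A : F, tensorLevel M S A.1)) :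
    ∃ A ∈ F, ∀ k, x k ∈ tensorLevel M S A := by
  choose A hA using fun k => (mem_iSup_tensorLevel hdir).1 (hx k)
  obtain ⟨A₀, hA₀⟩ := (directedOn_iff_directed.1 hdir).finite_le A
  exact ⟨A₀.1, A₀.2, fun k => tensorLevel_mono (hA₀ k) (hA k)⟩

/-- The bounds on the levels, whose union is dense, pass to the limit. -/
theorem isCompletelyBounded_of_isHyperfinite {M R : VonNeumannAlgebra H}
    {S : VonNeumannAlgebra K} (hS : NoAbelianProjection S) (hSh : IsHyperfinite S) (hRM : R ≤ M)
    {φ : (vnTensor M S).toStarSubalgebra →ₗ[ℂ]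
      (vnTensor M S).toStarSubalgebra →ₗ[ℂ] (vnTensor M S).toStarSubalgebra}
    (hφb : IsBoundedBilin φ) (hφn : IsSeparatelyNormal φ)
    (hφm : IsMultimodular φ (vnTensor R S)) : IsCompletelyBounded φ := by
  obtain ⟨C, hC⟩ := hφb
  obtain ⟨F, hF, hdir, hfin, hcl⟩ := hSh
  have hFS : ∀ A ∈ F, ∀ x ∈ A, x ∈ S := fun A hA x hx => by
    have h1 := @subset_closure _ (ultraweak K) (⋃ A ∈ F, (A : Set (K →L[ℂ] K))) x
      (Set.mem_biUnion hA hx)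
    rwa [hcl] at h1
  have : Nonempty F := hF.to_subtype
  refine ⟨4 * max C 0, fun n => matrixNorm_amplification_le_of_dense hφn
    (D := ⨆ A : F, tensorLevel M S A.1) (fun x hx => ?_)
    (fun T hT => inBicommutant_iSup_tensorLevel hF hcl hFS hT) (le_max_right _ _) ?_⟩
  · obtain ⟨A, hA⟩ := (mem_iSup_tensorLevel hdir).1 hx
    exact (mem_tensorLevel.1 hA).1
  intro X Y hX hY
  obtain ⟨A, hAF, hA⟩ := exists_tensorLevel_of_mem_iSup hdir
    (x := Sum.elim
      (fun p : Fin n × Fin n => (X p.1 p.2 : HilbertTensor H K →L[ℂ] HilbertTensor H K))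
      fun p : Fin n × Fin n => (Y p.1 p.2 : HilbertTensor H K →L[ℂ] HilbertTensor H K))
    (by rintro (p | p); exacts [hX _ _, hY _ _])
  have := hfin A hAF
  refine matrixNorm_amplification_le_of_mem_tensorLevel hS hRM hφm (le_max_right _ _)
    (fun x y => (hC x y).trans ?_) (hFS A hAF) (fun i j => hA (Sum.inl (i, j)))
    fun i j => hA (Sum.inr (i, j))
  gcongr
  exact le_max_left _ _

end TensorAlgebra

end VNTensor

end

theorem lemma2p2 {H : Type*} [NormedAddCommGroup H] [InnerProductSpace ℂ H] [CompleteSpace H]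
    {K : Type*} [NormedAddCommGroup K] [InnerProductSpace ℂ K] [CompleteSpace K]
    (M R : VonNeumannAlgebra H) (S : VonNeumannAlgebra K)
    (hM : VNTensor.IsTypeIIOne M) (hS : VNTensor.IsTypeIIOne S)
    (hSh : VNTensor.IsHyperfinite S)
    (hRM : R ≤ M) (hRh : VNTensor.IsHyperfinite R)
    (hRc : (R.commutant : Set (H →L[ℂ] H)) ∩ (M : Set (H →L[ℂ] H)) =
      (M.commutant : Set (H →L[ℂ] H)) ∩ (M : Set (H →L[ℂ] H)))
    (φ : (VNTensor.vnTensor M S).toStarSubalgebra →ₗ[ℂ]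
      (VNTensor.vnTensor M S).toStarSubalgebra →ₗ[ℂ] (VNTensor.vnTensor M S).toStarSubalgebra)
    (hφb : VNTensor.IsBoundedBilin φ)
    (hφn : VNTensor.IsSeparatelyNormal φ)
    (hφm : VNTensor.IsMultimodular φ (VNTensor.vnTensor R S)) :
    VNTensor.IsCompletelyBounded φ := by
  exact VNTensor.isCompletelyBounded_of_isHyperfinite hS.2 hSh hRM hφb hφn hφm
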